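/- Let $\mathfrak n$ be a finite-dimensional real Lie algebra with an inner product $g$, let $n=\dim\mathfrak n$, and suppose that $\mathfrak n$ is 2-step nilpotent, i.e. $[\mathfrak n,\mathfrak n]\neq 0$ and $[\mathfrak n,\mathfrak n]$ is contained in the center $\mathfrak z$. Let $\mathfrak v=\mathfrak z^\perp$. Let $\nabla$ be the Levi-Civita connection of left-invariant vector fields, given by $g(\nabla_xy,w)=\frac12\{g([x,y],w)+g([w,x],y)+g([w,y],x)\}$ and extended to $\Lambda^*\mathfrak n^*$ by derivations; let $\mathrm d$ be the Lie algebra differential, and $\mathrm d^*=-\sum_i e_i\lrcorner\nabla_{e_i}$ for an orthonormal basis $(e_i)$. A form $\alpha\in\Lambda^k\mathfrak n^*$ is conformal Killing if $$\nabla_y\alpha=\tfrac1{k+1}\,y\lrcorner \mathrm d\alpha-\tfrac1{n-k+1}\,y^\flat\wedge \mathrm d^*\alpha\qquad\text{for all }y\in\mathfrak n,$$ and Killing if moreover $\mathrm d^*\alpha=0$. It has odd $\mathfrak v$-degree if it lies in $\bigoplus_{d\text{ odd}}\Lambda^d\mathfrak v^*\otimes\Lambda^{k-d}\mathfrak z^*$.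 Denote by $\mathcal{CK}^k_{\rm odd}(\mathfrak n,g)$ the space of conformal Killing $k$-forms of odd $\mathfrak v$-degree. Let $\mathfrak n_{3,2}$ be the free 2-step nilpotent Lie algebra on 3 generators, with basis $v_1,v_2,v_3,u_1,u_2,u_3$ and non-zero brackets $[v_1,v_2]=u_3$, $[v_2,v_3]=u_1$, $[v_3,v_1]=u_2$ (up to skew-symmetry). For $\lambda>0$ let $g_\lambda$ be the inner product on $\mathfrak n_{3,2}$ for which $v_1,v_2,v_3,z_1,z_2,z_3$, with $z_i:=u_i/\lambda$, is an orthonormal basis. **Proposition.** (1) If $\dim\mathfrak z=3$, then either every conformal Killing 3-form of odd $\mathfrak v$-degree on $(\mathfrak n,g)$ vanishes, or $(\mathfrak n,g)$ is isometrically isomorphic to $(\mathfrak n_{3,2},g_\lambda)$ for some $\lambda>0$. (2) For every $\lambda>0$ the space $\mathcal{CK}^3_{\rm odd}(\mathfrak n_{3,2},g_\lambda)$ is 1-dimensional. Identifying vectors with their metric dual 1-forms, the form $$\eta=z_1\wedge v_2\wedge v_3+z_2\wedge v_3\wedge v_1+z_3\wedge v_1\wedge v_2+2\,z_1\wedge z_2\wedge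 z_3$$ is a Killing 3-form on $(\mathfrak n_{3,2},g_\lambda)$, and, for either orientation, $\mathcal{CK}^3_{\rm odd}(\mathfrak n_{3,2},g_\lambda)=\mathbb R\cdot *\eta$. -/

import Mathlib

open Module

namespace MetricLie

noncomputable section

/-- Exterior `k`-forms on a real vector space `V`, i.e. elements of `Λᵏ V*`. -/
abbrev Forms (V : Type*) [AddCommGroup V] [Module ℝ V] (k : ℕ) : Type _ := V [⋀^Fin k]→ₗ[ℝ] ℝ

/-- A metric (inner product) on a real vector space. -/
structure Metric (V : Type*) [AddCommGroup V] [Module ℝ V] where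
  /-- the underlying bilinear form -/
  form : LinearMap.BilinForm ℝ V
  symm : ∀ x y, form x y = form y x
  pos : ∀ x, x ≠ 0 → 0 < form x x

theorem append_update {X : Type*} {k m : ℕ} (a : Fin k → X) (x : Fin m → X) [DecidableEq (Fin m)]
    (i : Fin m) (v : X) :
    Fin.append a (Function.update x i v) =
      Function.update (Fin.append a x) (Fin.natAdd k i) v := by
  funext t
  refine Fin.addCases (fun s => ?_) (fun s => ?_) t
  · rw [Function.update_of_ne]
    · simp
    · intro h
      have := congrArg Fin.val h
      simp at this
      omega
  · rcases eq_or_ne s i with rfl | h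
    · simp
    · rw [Function.update_of_ne (by simpa using h)]
      simp [h]

section Algebra

variable {V : Type*} [AddCommGroup V] [Module ℝ V]

/-- Orthonormality of a family of vectors with respect to `g`. -/
def Metric.IsOrthonormal (g : Metric V) {ι : Type*} (e : ι → V) : Prop :=
  (∀ i, g.form (e i) (e i) = 1) ∧ ∀ i j, i ≠ j → g.form (e i) (e j) = 0

theorem Metric.nondegenerate (g : Metric V) : g.form.Nondegenerate := by
  refine ⟨fun x hx => ?_, fun x hx => ?_⟩ <;>
  · by_contra h
    exact (g.pos x h).ne' (hx x)

/-- The metric dual `1`-form `x♭ = g(x, ·)`, as a linear functional. -/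
def Metric.flat (g : Metric V) (x : V) : V →ₗ[ℝ] ℝ := g.form x

/-- A linear functional regarded as a `1`-form. -/
def oneForm (θ : V →ₗ[ℝ] ℝ) : Forms V 1 := AlternatingMap.ofSubsingleton ℝ V ℝ 0 θ

/-- Exterior product `θ ∧ ω` of a `1`-form with a `k`-form:
`(θ ∧ ω)(x₀, …, xₖ) = ∑ᵢ (-1)ⁱ θ(xᵢ) ω(x₀, …, x̂ᵢ, …, xₖ)`. -/
def wedge (θ : V →ₗ[ℝ] ℝ) {k : ℕ} (ω : Forms V k) : Forms V (k + 1) :=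
  AlternatingMap.alternatizeUncurryFin (θ.smulRight ω)

theorem wedge_apply (θ : V →ₗ[ℝ] ℝ) {k : ℕ} (ω : Forms V k) (x : Fin (k + 1) → V) :
    wedge θ ω x = ∑ i : Fin (k + 1), (-1 : ℝ) ^ (i : ℕ) * (θ (x i) * ω (i.removeNth x)) := by
  simp [wedge, AlternatingMap.alternatizeUncurryFin_apply]

/-- Interior product `x ⌟ α = α(x, ·, …, ·)`. -/
def interior (x : V) {k : ℕ} (α : Forms V (k + 1)) : Forms V k := α.curryLeft x

/-- The derivation of the exterior algebra `Λ* V*` induced by an endomorphism `A` of `V`: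
`(A · α)(x₁, …, xₖ) = - ∑ᵢ α(x₁, …, A xᵢ, …, xₖ)`. -/
def derivForm (A : V →ₗ[ℝ] V) {k : ℕ} (α : Forms V k) : Forms V k :=
  { (-∑ l : Fin k, α.toMultilinearMap.compLinearMap
        (fun i => if i = l then A else LinearMap.id) : MultilinearMap ℝ (fun _ : Fin k => V) ℝ) with
    map_eq_zero_of_eq' := by
      intro x i j hx hij
      have key : ∀ l : Fin k, (fun t => (if t = l then A else LinearMap.id) (x t)) =
          Function.update x l (A (x l)) := by
        intro l
        funext t
        by_cases h : t = l
        · subst h; simp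
        · simp [h]
      simp only [MultilinearMap.toFun_eq_coe, neg_apply, sum_apply,
        MultilinearMap.compLinearMap_apply, AlternatingMap.coe_multilinearMap, key, neg_eq_zero]
      rw [Finset.sum_eq_add i j hij]
      · have hsw : Function.update x j (A (x j)) =
            Function.update x i (A (x i)) ∘ Equiv.swap i j := by
          funext t
          rcases eq_or_ne t i with rfl | hti
          · simp [hij, hij.symm, hx]
          rcases eq_or_ne t j with rfl | htj
          · simp [hx]
          · simp [Equiv.swap_apply_of_ne_of_ne hti htj, hti, htj]
        rw [hsw, α.map_swap _ hij, add_neg_cancel]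
      · intro l _ hl
        exact α.map_eq_zero_of_eq _
          (by rw [Function.update_of_ne hl.1.symm, Function.update_of_ne hl.2.symm, hx]) hij
      · simp
      · simp }

theorem derivForm_apply (A : V →ₗ[ℝ] V) {k : ℕ} (α : Forms V k) (x : Fin k → V) :
    derivForm A α x = -∑ l : Fin k, α (Function.update x l (A (x l))) := by
  have key : ∀ l : Fin k, (fun t => (if t = l then A else LinearMap.id) (x t)) =
      Function.update x l (A (x l)) := by
    intro l
    funext t
    by_cases h : t = l
    · subst h; simp
    · simp [h]
  change (-∑ l : Fin k, α.toMultilinearMap.compLinearMap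
        (fun i => if i = l then A else LinearMap.id) : MultilinearMap ℝ (fun _ : Fin k => V) ℝ) x = _
  simp [key]

/-- `derivForm` as a linear map in both arguments. -/
def deriv (k : ℕ) : (V →ₗ[ℝ] V) →ₗ[ℝ] Forms V k →ₗ[ℝ] Forms V k :=
  LinearMap.mk₂ ℝ (fun A α => derivForm A α)
    (fun A B α => by
      ext x
      simp [derivForm_apply, Finset.sum_add_distrib, add_comm])
    (fun c A α => by
      ext x
      simp [derivForm_apply, Finset.mul_sum])
    (fun A α β => by
      ext x
      simp [derivForm_apply, Finset.sum_add_distrib, add_comm])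
    (fun c A α => by
      ext x
      simp [derivForm_apply, Finset.mul_sum])

theorem deriv_apply (A : V →ₗ[ℝ] V) {k : ℕ} (α : Forms V k) (x : Fin k → V) :
    deriv k A α x = -∑ l : Fin k, α (Function.update x l (A (x l))) :=
  derivForm_apply A α x

/-- Every metric on a finite-dimensional space has an orthonormal basis. -/
theorem Metric.exists_orthonormalBasis [FiniteDimensional ℝ V] (g : Metric V) :
    ∃ e : Basis (Fin (finrank ℝ V)) ℝ V, g.IsOrthonormal e := by
  let c : InnerProductSpace.Core ℝ V :=
    { inner := fun x y => g.form x y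
      conj_inner_symm := fun x y => by simp [g.symm x y]
      re_inner_nonneg := fun x => by
        by_cases h : x = 0
        · simp [h]
        · simpa using (g.pos x h).le
      add_left := fun x y z => by simp
      smul_left := fun x y r => by simp
      definite := fun x hx => by
        by_contra h
        exact (g.pos x h).ne' hx }
  let : NormedAddCommGroup V := c.toNormedAddCommGroup
  let : InnerProductSpace ℝ V := InnerProductSpace.ofCore c.toCore
  refine ⟨(stdOrthonormalBasis ℝ V).toBasis, fun i => ?_, fun i j hij => ?_⟩
  · have := orthonormal_iff_ite.1 (stdOrthonormalBasis ℝ V).orthonormal i i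
    rw [if_pos rfl] at this
    exact this
  · have := orthonormal_iff_ite.1 (stdOrthonormalBasis ℝ V).orthonormal i j
    rw [if_neg hij] at this
    exact this

/-- Some orthonormal basis of `(V, g)`. Nothing below depends on its choice. -/
def Metric.onb [FiniteDimensional ℝ V] (g : Metric V) : Basis (Fin (finrank ℝ V)) ℝ V :=
  g.exists_orthonormalBasis.choose

theorem Metric.onb_isOrthonormal [FiniteDimensional ℝ V] (g : Metric V) :
    g.IsOrthonormal g.onb :=
  g.exists_orthonormalBasis.choose_spec

theorem Metric.IsOrthonormal.sum_form_smul {g : Metric V} {ι : Type*} [Fintype ι]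
    {e : Basis ι ℝ V} (he : g.IsOrthonormal e) (x : V) : ∑ i, g.form (e i) x • e i = x := by
  classical
  have h : ∀ i, g.form (e i) x = e.repr x i := by
    intro i
    conv_lhs => rw [← e.sum_repr x]
    rw [map_sum, Finset.sum_eq_single i]
    · simp [he.1 i]
    · intro j _ hj
      simp [he.2 i j hj.symm]
    · simp
  simp only [h, e.sum_repr]

/-- The metric trace of a bilinear map can be computed in any orthonormal basis. -/
theorem Metric.IsOrthonormal.sum_eq {g : Metric V} {ι κ : Type*} [Fintype ι] [Fintype κ]
    {e : Basis ι ℝ V} {f : Basis κ ℝ V} (he : g.IsOrthonormal e) (hf : g.IsOrthonormal f)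
    {W : Type*} [AddCommGroup W] [Module ℝ W] (B : V →ₗ[ℝ] V →ₗ[ℝ] W) :
    ∑ i, B (e i) (e i) = ∑ j, B (f j) (f j) := by
  calc ∑ i, B (e i) (e i) = ∑ i, ∑ j, g.form (f j) (e i) • B (f j) (e i) := by
        refine Finset.sum_congr rfl fun i _ => ?_
        have := congrArg (fun w => B w (e i)) (hf.sum_form_smul (e i))
        simpa using this.symm
    _ = ∑ j, ∑ i, g.form (f j) (e i) • B (f j) (e i) := Finset.sum_comm
    _ = ∑ j, B (f j) (f j) := by
        refine Finset.sum_congr rfl fun j _ => ?_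
        have := congrArg (fun w => B (f j) w) (he.sum_form_smul (f j))
        simpa [g.symm (f j)] using this

/-- `vol` is the Riemannian volume form of one of the orientations of `V`, i.e. it takes the
value `1` on some (ordered) orthonormal basis. -/
def Metric.IsVolumeForm (g : Metric V) {n : ℕ} (vol : Forms V n) : Prop :=
  ∃ e : Basis (Fin n) ℝ V, g.IsOrthonormal e ∧ vol = e.det

/-- Insertion of `k` vectors `a` in the first `k` slots of a form `ω`:
`(x₁, …, xₘ) ↦ ω(a₁, …, aₖ, x₁, …, xₘ)`. -/
def insertVectors {k m : ℕ} (a : Fin k → V) (ω : Forms V (k + m)) : Forms V m where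
  toFun x := ω (Fin.append a x)
  map_update_add' x i v w := by simp only [append_update, AlternatingMap.map_update_add]
  map_update_smul' x i c v := by simp only [append_update, AlternatingMap.map_update_smul]
  map_eq_zero_of_eq' x i j hx hij :=
    ω.map_eq_zero_of_eq (i := Fin.natAdd k i) (j := Fin.natAdd k j) _ (by simpa using hx)
      (by simpa using hij)

/-- The Hodge star `* : Λᵏ V* → Λᵐ V*`, `k + m = dim V`, for the orientation with volume form `vol`:
`(*β)(x₁, …, xₘ) = (1/k!) ∑ β(e_{i₁}, …, e_{iₖ}) vol(e_{i₁}, …, e_{iₖ}, x₁, …, xₘ)`, where the sum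
runs over all `i₁, …, iₖ` and `e` is an orthonormal basis. Thus
`*(e¹ ∧ ⋯ ∧ eᵏ) = eᵏ⁺¹ ∧ ⋯ ∧ eⁿ` for an oriented orthonormal basis. -/
def Metric.hodgeStar [FiniteDimensional ℝ V] (g : Metric V) {k m : ℕ} (vol : Forms V (k + m))
    (β : Forms V k) : Forms V m :=
  ((k.factorial : ℝ)⁻¹) • ∑ i : Fin k → Fin (finrank ℝ V),
    β (fun s => g.onb (i s)) • insertVectors (fun s => g.onb (i s)) vol

end Algebra

section Lie

/-- A Lie algebra is `2`-step nilpotent if its commutator is non-trivial and contained in its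
center. -/
structure IsTwoStepNilpotent (𝔫 : Type*) [LieRing 𝔫] [LieAlgebra ℝ 𝔫] : Prop where
  not_abelian : ¬ IsLieAbelian 𝔫
  lie_mem_center : ∀ x y : 𝔫, ⁅x, y⁆ ∈ LieAlgebra.center ℝ 𝔫

variable {𝔫 : Type*} [LieRing 𝔫] [LieAlgebra ℝ 𝔫]

/-- The linear functional `w ↦ ½ {g([x,y],w) + g([w,x],y) + g([w,y],x)}` of Koszul's formula. -/
def Metric.koszul (g : Metric 𝔫) (x y : 𝔫) : Dual ℝ 𝔫 where
  toFun w := (1 / 2 : ℝ) * (g.form ⁅x, y⁆ w + g.form ⁅w, x⁆ y + g.form ⁅w, y⁆ x)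
  map_add' v w := by
    simp only [add_lie, map_add, LinearMap.add_apply]
    ring
  map_smul' c w := by
    simp only [smul_lie, map_smul, LinearMap.smul_apply, smul_eq_mul, RingHom.id_apply]
    ring

theorem Metric.koszul_apply (g : Metric 𝔫) (x y w : 𝔫) :
    g.koszul x y w = (1 / 2 : ℝ) * (g.form ⁅x, y⁆ w + g.form ⁅w, x⁆ y + g.form ⁅w, y⁆ x) :=
  rfl

/-- The Levi-Civita connection `∇ : 𝔫 → End 𝔫` on left-invariant vector fields. -/
def Metric.nabla [FiniteDimensional ℝ 𝔫] (g : Metric 𝔫) : 𝔫 →ₗ[ℝ] 𝔫 →ₗ[ℝ] 𝔫 :=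
  LinearMap.mk₂ ℝ (fun x y => (g.form.toDual g.nondegenerate).symm (g.koszul x y))
    (fun x x' y => by
      rw [← map_add]
      congr 1
      ext w
      simp only [koszul_apply, LinearMap.add_apply, add_lie, lie_add, map_add]
      ring)
    (fun c x y => by
      rw [← map_smul]
      congr 1
      ext w
      simp only [koszul_apply, LinearMap.smul_apply, smul_lie, lie_smul, map_smul, smul_eq_mul]
      ring)
    (fun x y y' => by
      rw [← map_add]
      congr 1
      ext w
      simp only [koszul_apply, LinearMap.add_apply, lie_add, map_add]
      ring)
    (fun c x y => by
      rw [← map_smul]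
      congr 1
      ext w
      simp only [koszul_apply, LinearMap.smul_apply, lie_smul, map_smul, smul_eq_mul]
      ring)

/-- Koszul's formula. -/
theorem Metric.form_nabla [FiniteDimensional ℝ 𝔫] (g : Metric 𝔫) (x y w : 𝔫) :
    g.form (g.nabla x y) w =
      (1 / 2 : ℝ) * (g.form ⁅x, y⁆ w + g.form ⁅w, x⁆ y + g.form ⁅w, y⁆ x) := by
  rw [← koszul_apply]
  exact LinearMap.BilinForm.apply_toDual_symm_apply (hB := g.nondegenerate)
    (g.koszul x y) w

/-- The covariant derivative `∇_y α` of a left-invariant form, as a linear map in `y` and `α`. -/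
def Metric.nablaForm [FiniteDimensional ℝ 𝔫] (g : Metric 𝔫) (k : ℕ) :
    𝔫 →ₗ[ℝ] Forms 𝔫 k →ₗ[ℝ] Forms 𝔫 k :=
  deriv k ∘ₗ g.nabla

/-- The Lie derivative `L_y α` of a left-invariant form along a left-invariant vector field,
`(L_y α)(x₁, …, xₖ) = - ∑ᵢ α(x₁, …, [y, xᵢ], …, xₖ)`. -/
def lieDeriv (k : ℕ) : 𝔫 →ₗ[ℝ] Forms 𝔫 k →ₗ[ℝ] Forms 𝔫 k :=
  deriv k ∘ₗ (LieAlgebra.ad ℝ 𝔫 : 𝔫 →ₗ[ℝ] 𝔫 →ₗ[ℝ] 𝔫)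

/-- The Lie algebra (Chevalley-Eilenberg) differential, `dα = ½ ∑ᵢ eⁱ ∧ L_{eᵢ} α`;
the usual formula in terms of brackets is `extDeriv_apply` below. -/
def extDeriv (k : ℕ) : Forms 𝔫 k →ₗ[ℝ] Forms 𝔫 (k + 1) :=
  (1 / 2 : ℝ) • (AlternatingMap.alternatizeUncurryFinLM ∘ₗ (lieDeriv k).flip)

/-- `dα(x₀, …, x_{k+1}) = ∑_{a < b} (-1)^{a+b} α([x_a, x_b], x₀, …, x̂_a, …, x̂_b, …, x_{k+1})`.
Here `(a, b)` is written as `(i, j + 1)` with `i ≤ j`, whence the sign in front of the sum. -/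
theorem extDeriv_apply {k : ℕ} (α : Forms 𝔫 (k + 1)) (x : Fin (k + 2) → 𝔫) :
    extDeriv (k + 1) α x = -∑ i : Fin (k + 1), ∑ j ∈ Finset.Ici i,
      (-1 : ℝ) ^ (i + j : ℕ) *
        α (Matrix.vecCons ⁅x i.castSucc, x j.succ⁆ (j.removeNth (i.castSucc.removeNth x))) := by
  have h : extDeriv (k + 1) α x = (1 / 2 : ℝ) * ∑ i : Fin (k + 2), ∑ j : Fin (k + 1),
      -((-1 : ℝ) ^ (i : ℕ) * α (Function.update (i.removeNth x) j ⁅x i, i.removeNth x j⁆)) := by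
    simp [extDeriv, AlternatingMap.alternatizeUncurryFin_apply, lieDeriv, deriv_apply,
      Finset.mul_sum]
  rw [h, Fin.sum_sum_eq_sum_triangle_add, Finset.mul_sum, ← Finset.sum_neg_distrib]
  refine Fintype.sum_congr _ _ fun i => ?_
  rw [Finset.mul_sum, ← Finset.sum_neg_distrib]
  refine Finset.sum_congr rfl fun j hj => ?_
  rw [Finset.mem_Ici] at hj
  have H₁ : i.castSucc.succAbove j = j.succ := by simp [Fin.succAbove_of_le_castSucc, hj]
  have H₂ : j.predAbove i.castSucc = i := by simp [Fin.predAbove_of_le_castSucc, hj]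
  have H₃ : j.succ.succAbove i = i.castSucc := by simp [Fin.succAbove_of_castSucc_lt, hj]
  simp only [← Fin.insertNth_removeNth, AlternatingMap.map_insertNth]
  have e1 : j.removeNth (i.castSucc.removeNth x) = i.removeNth (j.succ.removeNth x) := by
    rw [Fin.removeNth_removeNth_eq_swap, H₁, H₂]
  have e2 : i.castSucc.removeNth x j = x j.succ := by rw [Fin.removeNth_apply, H₁]
  have e3 : j.succ.removeNth x i = x i.castSucc := by rw [Fin.removeNth_apply, H₃]
  have e4 : α (Matrix.vecCons ⁅x j.succ, x i.castSucc⁆ (i.removeNth (j.succ.removeNth x))) =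
      -α (Matrix.vecCons ⁅x i.castSucc, x j.succ⁆ (i.removeNth (j.succ.removeNth x))) := by
    rw [← lie_skew, ← neg_one_smul ℝ, AlternatingMap.map_vecCons_smul, neg_one_smul]
  rw [e2, e3, e4, e1, Fin.val_castSucc, Fin.val_succ]
  simp only [zsmul_eq_mul, Int.cast_pow, Int.cast_neg, Int.cast_one, pow_add,
    pow_one]
  ring

/-- The codifferential `d*α = - ∑ᵢ eᵢ ⌟ ∇_{eᵢ} α`. -/
def Metric.codiff [FiniteDimensional ℝ 𝔫] (g : Metric 𝔫) (k : ℕ) :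
    Forms 𝔫 (k + 1) →ₗ[ℝ] Forms 𝔫 k where
  toFun α := -∑ i, interior (g.onb i) (g.nablaForm (k + 1) (g.onb i) α)
  map_add' α β := by
    simp only [interior, map_add, AlternatingMap.curryLeft_add, LinearMap.add_apply,
      Finset.sum_add_distrib, neg_add]
  map_smul' c α := by
    simp only [interior, map_smul, AlternatingMap.curryLeft_smul, LinearMap.smul_apply,
      Finset.smul_sum, smul_neg, RingHom.id_apply]

/-- The codifferential can be computed in any orthonormal basis. -/
theorem Metric.codiff_eq [FiniteDimensional ℝ 𝔫] (g : Metric 𝔫) {k : ℕ} {ι : Type*} [Fintype ι]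
    {e : Basis ι ℝ 𝔫} (he : g.IsOrthonormal e) (α : Forms 𝔫 (k + 1)) :
    g.codiff k α = -∑ i, interior (e i) (g.nablaForm (k + 1) (e i) α) := by
  have := g.onb_isOrthonormal.sum_eq he
    (AlternatingMap.curryLeftLinearMap ∘ₗ (g.nablaForm (k + 1)).flip α)
  exact congrArg Neg.neg this

/-- The space of conformal Killing forms of degree `k + 1` on `(𝔫, g)`, i.e. of the forms `α` with
`∇_y α = 1/(p+1) y ⌟ dα - 1/(n-p+1) y♭ ∧ d*α` for all `y`, where `p = k + 1` and `n = dim 𝔫`. -/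
def Metric.conformalKilling [FiniteDimensional ℝ 𝔫] (g : Metric 𝔫) (k : ℕ) :
    Submodule ℝ (Forms 𝔫 (k + 1)) where
  carrier := {α | ∀ y : 𝔫, g.nablaForm (k + 1) y α =
    (1 / (((k + 1 : ℕ) : ℝ) + 1)) • interior y (extDeriv (k + 1) α) -
      (1 / ((finrank ℝ 𝔫 : ℝ) - ((k + 1 : ℕ) : ℝ) + 1)) • wedge (g.flat y) (g.codiff k α)}
  zero_mem' := by
    intro y
    ext x
    simp [interior, wedge_apply]
  add_mem' := by
    intro α β hα hβ y
    ext x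
    have h1 := congrArg (fun ω => ω x) (hα y)
    have h2 := congrArg (fun ω => ω x) (hβ y)
    simp only [interior, wedge_apply, map_add, AlternatingMap.add_apply, AlternatingMap.sub_apply,
      AlternatingMap.smul_apply, AlternatingMap.curryLeft_apply_apply, smul_eq_mul, mul_add,
      Finset.sum_add_distrib] at h1 h2 ⊢
    linear_combination h1 + h2
  smul_mem' := by
    intro c α hα y
    ext x
    have h1 := congrArg (fun ω => ω x) (hα y)
    simp only [interior, wedge_apply, map_smul, AlternatingMap.sub_apply,
      AlternatingMap.smul_apply, AlternatingMap.curryLeft_apply_apply, smul_eq_mul,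
      mul_left_comm _ c, ← Finset.mul_sum] at h1 ⊢
    linear_combination c * h1

/-- The space of Killing forms of degree `k + 1`: coclosed conformal Killing forms. -/
def Metric.killing [FiniteDimensional ℝ 𝔫] (g : Metric 𝔫) (k : ℕ) :
    Submodule ℝ (Forms 𝔫 (k + 1)) :=
  g.conformalKilling k ⊓ LinearMap.ker (g.codiff k)

/-- The orthogonal complement `𝔳` of the center. -/
def Metric.v (g : Metric 𝔫) : Submodule ℝ 𝔫 :=
  g.form.orthogonal (LieAlgebra.center ℝ 𝔫).toSubmodule

/-- The summand `Λᵈ𝔳* ⊗ Λᵏ⁻ᵈ𝔷*` of `Λᵏ𝔫*`: the `k`-forms that vanish on `k` vectors of `𝔳 ∪ 𝔷`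
unless exactly `d` of them are taken from `𝔳` and the others from the center `𝔷`. -/
def Metric.vDegree (g : Metric 𝔫) (k d : ℕ) : Submodule ℝ (Forms 𝔫 k) where
  carrier := {α | ∀ (S : Finset (Fin k)) (x : Fin k → 𝔫), S.card ≠ d → (∀ i ∈ S, x i ∈ g.v) →
    (∀ i ∉ S, x i ∈ LieAlgebra.center ℝ 𝔫) → α x = 0}
  zero_mem' := by simp
  add_mem' := by
    intro α β hα hβ S x h1 h2 h3
    simp [hα S x h1 h2 h3, hβ S x h1 h2 h3]
  smul_mem' := by
    intro c α hα S x h1 h2 h3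
    simp [hα S x h1 h2 h3]

/-- The `k`-forms of odd `𝔳`-degree: the sum of the `Λᵈ𝔳* ⊗ Λᵏ⁻ᵈ𝔷*` with `d` odd. -/
def Metric.oddForms (g : Metric 𝔫) (k : ℕ) : Submodule ℝ (Forms 𝔫 k) :=
  ⨆ (d : ℕ) (_ : Odd d), g.vDegree k d

/-- The space of conformal Killing `(k+1)`-forms of odd `𝔳`-degree. -/
def Metric.oddConformalKilling [FiniteDimensional ℝ 𝔫] (g : Metric 𝔫) (k : ℕ) :
    Submodule ℝ (Forms 𝔫 (k + 1)) :=
  g.conformalKilling k ⊓ g.oddForms (k + 1)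

end Lie

section Free

open scoped Matrix

/-- The free `2`-step nilpotent Lie algebra `𝔫_{3,2}` on three generators. The pair `(a, b)` is
`∑ aᵢ vᵢ + ∑ bᵢ uᵢ`, with `[v₁,v₂] = u₃`, `[v₂,v₃] = u₁`, `[v₃,v₁] = u₂`, all other brackets of
basis vectors being zero. -/
def N32 : Type := (Fin 3 → ℝ) × (Fin 3 → ℝ)

instance : AddCommGroup N32 := inferInstanceAs (AddCommGroup ((Fin 3 → ℝ) × (Fin 3 → ℝ)))

instance : Module ℝ N32 := inferInstanceAs (Module ℝ ((Fin 3 → ℝ) × (Fin 3 → ℝ)))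

instance : FiniteDimensional ℝ N32 :=
  inferInstanceAs (FiniteDimensional ℝ ((Fin 3 → ℝ) × (Fin 3 → ℝ)))

namespace N32

/-- Components along the generators. -/
def fst : N32 →ₗ[ℝ] (Fin 3 → ℝ) := LinearMap.fst ℝ _ _

/-- Components along the center. -/
def snd : N32 →ₗ[ℝ] (Fin 3 → ℝ) := LinearMap.snd ℝ _ _

/-- The element with given components. -/
def mk (a b : Fin 3 → ℝ) : N32 := (a, b)

@[simp] theorem fst_mk (a b : Fin 3 → ℝ) : fst (mk a b) = a := rfl

@[simp] theorem snd_mk (a b : Fin 3 → ℝ) : snd (mk a b) = b := rfl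

theorem ext {x y : N32} (h1 : fst x = fst y) (h2 : snd x = snd y) : x = y := Prod.ext h1 h2

instance : Bracket N32 N32 := ⟨fun x y => mk 0 (crossProduct (fst x) (fst y))⟩

theorem lie_def (x y : N32) : ⁅x, y⁆ = mk 0 (crossProduct (fst x) (fst y)) := rfl

instance : LieRing N32 where
  add_lie x y z := ext (by simp [lie_def]) (by simp [lie_def])
  lie_add x y z := ext (by simp [lie_def]) (by simp [lie_def])
  lie_self x := ext (by simp [lie_def]) (by simp [lie_def])
  leibniz_lie x y z := ext (by simp [lie_def]) (by simp [lie_def])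

instance : LieAlgebra ℝ N32 where
  lie_smul c x y := ext (by simp [lie_def]) (by simp [lie_def])

/-- The basis vectors `v₁, v₂, v₃`. -/
def v (i : Fin 3) : N32 := mk (Pi.single i 1) 0

/-- The basis vectors `u₁, u₂, u₃` of the center. -/
def u (i : Fin 3) : N32 := mk 0 (Pi.single i 1)

/-- The metric `g_λ`, for which `v₁, v₂, v₃, u₁/λ, u₂/λ, u₃/λ` is orthonormal. -/
def metric (lam : ℝ) (hlam : 0 < lam) : Metric N32 where
  form := LinearMap.mk₂ ℝ (fun x y => fst x ⬝ᵥ fst y + lam ^ 2 * (snd x ⬝ᵥ snd y))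
    (fun x x' y => by simp [add_dotProduct]; ring)
    (fun c x y => by simp [smul_dotProduct]; ring)
    (fun x y y' => by simp [dotProduct_add]; ring)
    (fun c x y => by simp [dotProduct_smul]; ring)
  symm x y := by simp [dotProduct_comm]
  pos x hx := by
    have h1 : 0 ≤ fst x ⬝ᵥ fst x := Finset.sum_nonneg fun i _ => mul_self_nonneg _
    have h2 : 0 ≤ snd x ⬝ᵥ snd x := Finset.sum_nonneg fun i _ => mul_self_nonneg _
    have h3 : 0 < lam ^ 2 := by positivity
    rw [LinearMap.mk₂_apply]
    by_contra hcon
    have h4 : 0 ≤ lam ^ 2 * (snd x ⬝ᵥ snd x) := by positivity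
    have h5 : fst x ⬝ᵥ fst x = 0 := by linarith
    have h6 : lam ^ 2 * (snd x ⬝ᵥ snd x) = 0 := by linarith
    have h7 : snd x ⬝ᵥ snd x = 0 := by simpa [h3.ne'] using h6
    exact hx (ext (by simpa using dotProduct_self_eq_zero.1 h5)
      (by simpa using dotProduct_self_eq_zero.1 h7))

/-- The `3`-form `η = z₁∧v₂∧v₃ + z₂∧v₃∧v₁ + z₃∧v₁∧v₂ + 2 z₁∧z₂∧z₃` on `(𝔫_{3,2}, g_λ)`, where
`zᵢ = uᵢ/λ` and vectors are identified with their `g_λ`-dual `1`-forms. -/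
def eta (lam : ℝ) (hlam : 0 < lam) : Forms N32 3 :=
  let V : Fin 3 → N32 →ₗ[ℝ] ℝ := fun i => (metric lam hlam).flat (v i)
  let Z : Fin 3 → N32 →ₗ[ℝ] ℝ := fun i => (metric lam hlam).flat (lam⁻¹ • u i)
  wedge (Z 0) (wedge (V 1) (oneForm (V 2))) + wedge (Z 1) (wedge (V 2) (oneForm (V 0))) +
    wedge (Z 2) (wedge (V 0) (oneForm (V 1))) +
    (2 : ℝ) • wedge (Z 0) (wedge (Z 1) (oneForm (Z 2)))

end N32

end Free

end

end MetricLie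

open MetricLie

namespace MetricLie

open scoped Matrix

/-! ### Degree-three forms evaluated on explicit triples -/

section Evaluation

variable {𝔫 : Type*} [LieRing 𝔫] [LieAlgebra ℝ 𝔫]

/-! A 3-form of odd `𝔳`-degree has a part in `𝔳* ⊗ Λ²𝔷*` and a part `γ` in `Λ³𝔳*`. When `dim 𝔷 = 3`,
an isometry `ζ : ℝ³ → 𝔷` and the cross product identify `Λ²𝔷` with `ℝ³`, so the first part is a
linear map `b : ℝ³ → 𝔳`, and the `𝔳 ⊗ 𝔷` part of `d*α` is, up to scale, another such map `c`. Write
`j z` for the skew endomorphism of `𝔳` with `g (j z x, y) = g ([x, y], ζ z)`. Two components of the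
conformal Killing equation suffice: `j z (b w) = c (z × w)`, and a formula for `γ (j z x, a, y)` in
terms of `b` and `c`. The common kernel of the `j z` is zero, so their images span `𝔳` and `α` is
determined by `b` (`CenterParam.eq_zero_of_forall_vzz`).

Let `b ≠ 0`. The relation `γ (j z x, j z x, y) = 0` and the skewness of `j` are so restrictive on
`ℝ³` that the pullbacks of `g` by `b` and by `c` are nonzero multiples of the dot product, and that
`c = κ b` with `κ ≠ 0` (`CenterData.exists_form_c_c`, `CenterData.exists_form_b_b`,
`CenterData.c_eq_smul_b`). On the orthogonal complement of the image of `b` the maps `j z` would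
satisfy incompatible quaternion-like relations, so this complement is zero
(`CenterData.eq_zero_of_orthogonal_b`). Hence `b` is a homothety onto `𝔳` that turns the bracket
into a multiple of the cross product, which is the description of `(𝔫_{3,2}, g_λ)` with `λ = |κ|`.

On `𝔫_{3,2}` itself, `j z` is `λ` times the cross product with `z`. Then `j z (b z) = c (z × z) = 0`
makes `b z` parallel to `z` for every `z`, so `b` is a multiple of the identity and the space has
dimension at most one. An explicit form `omega`, proportional to `*η`, spans it. -/

theorem extDeriv_three_apply (α : Forms 𝔫 3) (x a b c : 𝔫) :
    extDeriv 3 α ![x, a, b, c] =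
      -α ![⁅x, a⁆, b, c] + α ![⁅x, b⁆, a, c] - α ![⁅x, c⁆, a, b] - α ![⁅a, b⁆, x, c] +
        α ![⁅a, c⁆, x, b] - α ![⁅b, c⁆, x, a] := by
  rw [extDeriv_apply]
  have h0 : Finset.Ici (0 : Fin 3) = {0, 1, 2} := by decide
  have h1 : Finset.Ici (1 : Fin 3) = {1, 2} := by decide
  have h2 : Finset.Ici (2 : Fin 3) = {2} := by decide
  have r : ∀ i : Fin 3, ∀ j : Fin 3, j.removeNth (i.castSucc.removeNth ![x, a, b, c]) =
      ![i.castSucc.removeNth ![x, a, b, c] (j.succAbove 0),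
        i.castSucc.removeNth ![x, a, b, c] (j.succAbove 1)] := by
    intro i j
    funext t
    fin_cases t <;> rfl
  simp only [r, Fin.removeNth_apply]
  refine (congrArg Neg.neg (Fin.sum_univ_three _)).trans ?_
  rw [h0, h1, h2, Finset.sum_insert (by decide), Finset.sum_insert (by decide),
    Finset.sum_singleton, Finset.sum_insert (by decide), Finset.sum_singleton,
    Finset.sum_singleton]
  simp [Fin.succAbove]
  ring

theorem wedge_two_apply (θ : 𝔫 →ₗ[ℝ] ℝ) (δ : Forms 𝔫 2) (a b c : 𝔫) :
    wedge θ δ ![a, b, c] = θ a * δ ![b, c] - θ b * δ ![a, c] + θ c * δ ![a, b] := by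
  rw [wedge_apply]
  have r : ∀ i : Fin 3, i.removeNth ![a, b, c] =
      ![(![a, b, c] : Fin 3 → 𝔫) (i.succAbove 0), (![a, b, c] : Fin 3 → 𝔫) (i.succAbove 1)] := by
    intro i
    funext t
    fin_cases t <;> rfl
  simp only [r]
  refine (Fin.sum_univ_three _).trans ?_
  simp [Fin.succAbove]
  ring

theorem deriv_three_apply (A : 𝔫 →ₗ[ℝ] 𝔫) (α : Forms 𝔫 3) (a b c : 𝔫) :
    deriv 3 A α ![a, b, c] = -(α ![A a, b, c] + α ![a, A b, c] + α ![a, b, A c]) := by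
  rw [deriv_apply]
  have h0 : Function.update ![a, b, c] 0 (A a) = ![A a, b, c] := by
    funext t; fin_cases t <;> simp
  have h1 : Function.update ![a, b, c] 1 (A b) = ![a, A b, c] := by
    funext t; fin_cases t <;> simp
  have h2 : Function.update ![a, b, c] 2 (A c) = ![a, b, A c] := by
    funext t; fin_cases t <;> simp
  simp [Fin.sum_univ_three, h0, h1, h2]

/-- Here the degree is 3, so the coefficients are `1/(3+1)` and `1/(n-3+1) = 1/(n-2)`. -/
theorem mem_conformalKilling_two [FiniteDimensional ℝ 𝔫] (g : Metric 𝔫) (α : Forms 𝔫 3) :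
    α ∈ g.conformalKilling 2 ↔ ∀ y a b c : 𝔫,
      -(α ![g.nabla y a, b, c] + α ![a, g.nabla y b, c] + α ![a, b, g.nabla y c]) =
      1 / 4 * extDeriv 3 α ![y, a, b, c] - 1 / ((finrank ℝ 𝔫 : ℝ) - 2) *
        (g.form y a * g.codiff 2 α ![b, c] - g.form y b * g.codiff 2 α ![a, c] +
          g.form y c * g.codiff 2 α ![a, b]) := by
  have key : ∀ y a b c : 𝔫, ((1 / (((2 + 1 : ℕ) : ℝ) + 1)) • interior y (extDeriv (2 + 1) α) -
      (1 / ((finrank ℝ 𝔫 : ℝ) - ((2 + 1 : ℕ) : ℝ) + 1)) •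
        wedge (g.flat y) (g.codiff 2 α)) ![a, b, c] =
      1 / 4 * extDeriv 3 α ![y, a, b, c] - 1 / ((finrank ℝ 𝔫 : ℝ) - 2) *
        (g.form y a * g.codiff 2 α ![b, c] - g.form y b * g.codiff 2 α ![a, c] +
          g.form y c * g.codiff 2 α ![a, b]) := by
    intro y a b c
    have h2 : ((finrank ℝ 𝔫 : ℝ) - ((2 + 1 : ℕ) : ℝ) + 1) = (finrank ℝ 𝔫 : ℝ) - 2 := by
      push_cast; ring
    have h4 : (((2 + 1 : ℕ) : ℝ) + 1) = 4 := by norm_num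
    rw [h2, h4, AlternatingMap.sub_apply, AlternatingMap.smul_apply, AlternatingMap.smul_apply,
      wedge_two_apply]
    rfl
  constructor
  · intro h y a b c
    rw [← key, ← h y]
    exact (deriv_three_apply _ _ _ _ _).symm
  · intro h y
    ext x
    have hx : x = ![x 0, x 1, x 2] := by
      funext t; fin_cases t <;> rfl
    rw [hx, key, ← h]
    exact deriv_three_apply _ _ _ _ _

/-- Forms of odd `𝔳`-degree vanish on an even number of vectors of `𝔳` and vectors of `𝔷`. -/
theorem Metric.oddForms_apply_eq_zero {g : Metric 𝔫} {k : ℕ} {α : Forms 𝔫 k}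
    (hα : α ∈ g.oddForms k) (S : Finset (Fin k)) (hS : Even S.card) (x : Fin k → 𝔫)
    (hv : ∀ i ∈ S, x i ∈ g.v) (hz : ∀ i ∉ S, x i ∈ LieAlgebra.center ℝ 𝔫) : α x = 0 := by
  -- Vanishing at the fixed tuple `x` is a linear condition, so it passes from the summands of odd
  -- degree to their supremum.
  let W : Submodule ℝ (Forms 𝔫 k) :=
    { carrier := {α | α x = 0}
      zero_mem' := by simp
      add_mem' := by
        intro a b ha hb
        simp_all
      smul_mem' := by
        intro c a ha
        simp_all }
  have : g.oddForms k ≤ W := by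
    refine iSup₂_le fun d hd β hβ => ?_
    refine hβ S x ?_ hv hz
    rintro rfl
    exact (Nat.not_odd_iff_even.2 hS) hd
  exact this hα

end Evaluation

/-! ### The maps `J z` and the Levi-Civita connection of a 2-step nilpotent metric Lie algebra -/

section Structure

variable {𝔫 : Type*} [LieRing 𝔫] [LieAlgebra ℝ 𝔫]

theorem Metric.eq_of_form_eq {V : Type*} [AddCommGroup V] [Module ℝ V] (g : Metric V) {x y : V}
    (h : ∀ w, g.form x w = g.form y w) : x = y := by
  by_contra hne
  have := g.pos (x - y) (sub_ne_zero.2 hne)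
  simp [h] at this

theorem lie_eq_zero_of_mem_center {x : 𝔫} (hx : x ∈ LieAlgebra.center ℝ 𝔫) (y : 𝔫) :
    ⁅x, y⁆ = 0 := by
  rw [← lie_skew, (LieModule.mem_maxTrivSubmodule ℝ 𝔫 𝔫 x).1 hx y, neg_zero]

theorem lie_eq_zero_of_mem_center' {x : 𝔫} (hx : x ∈ LieAlgebra.center ℝ 𝔫) (y : 𝔫) :
    ⁅y, x⁆ = 0 :=
  (LieModule.mem_maxTrivSubmodule ℝ 𝔫 𝔫 x).1 hx y

theorem Metric.mem_v {g : Metric 𝔫} {x : 𝔫} :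
    x ∈ g.v ↔ ∀ z ∈ LieAlgebra.center ℝ 𝔫, g.form z x = 0 := Iff.rfl

theorem Metric.form_center_v {g : Metric 𝔫} {x z : 𝔫} (hx : x ∈ g.v)
    (hz : z ∈ LieAlgebra.center ℝ 𝔫) : g.form z x = 0 := hx z hz

theorem Metric.form_v_center {g : Metric 𝔫} {x z : 𝔫} (hx : x ∈ g.v)
    (hz : z ∈ LieAlgebra.center ℝ 𝔫) : g.form x z = 0 := by
  rw [g.symm]; exact hx z hz

variable [FiniteDimensional ℝ 𝔫]

/-- The maps `J z`, skew for central `z`, with `g (J z x, y) = g ([x, y], z)`. -/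
noncomputable def Metric.J (g : Metric 𝔫) : 𝔫 →ₗ[ℝ] 𝔫 →ₗ[ℝ] 𝔫 := (-2 : ℝ) • g.nabla.flip

theorem Metric.nabla_eq_J (g : Metric 𝔫) (x z : 𝔫) :
    g.nabla x z = (-(1 / 2) : ℝ) • g.J z x := by
  simp [Metric.J, smul_smul]

theorem Metric.form_J (g : Metric 𝔫) {z : 𝔫} (hz : z ∈ LieAlgebra.center ℝ 𝔫) (x w : 𝔫) :
    g.form (g.J z x) w = g.form ⁅x, w⁆ z := by
  simp only [Metric.J, LinearMap.smul_apply, LinearMap.flip_apply, map_smul, g.form_nabla,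
    lie_eq_zero_of_mem_center' hz, map_zero, LinearMap.zero_apply, smul_eq_mul]
  rw [← lie_skew x w, map_neg, LinearMap.neg_apply]
  ring

theorem Metric.J_mem_v (g : Metric 𝔫) {z : 𝔫} (hz : z ∈ LieAlgebra.center ℝ 𝔫) (x : 𝔫) :
    g.J z x ∈ g.v := by
  intro w hw
  change g.form w (g.J z x) = 0
  rw [g.symm, g.form_J hz, lie_eq_zero_of_mem_center' hw, map_zero, LinearMap.zero_apply]

theorem Metric.nabla_center_left (g : Metric 𝔫) {z : 𝔫} (hz : z ∈ LieAlgebra.center ℝ 𝔫) (x : 𝔫) :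
    g.nabla z x = (-(1 / 2) : ℝ) • g.J z x := by
  refine g.eq_of_form_eq fun w => ?_
  rw [map_smul, LinearMap.smul_apply, g.form_J hz, g.form_nabla, lie_eq_zero_of_mem_center hz,
    lie_eq_zero_of_mem_center' hz, ← lie_skew w x, map_neg, map_zero]
  simp only [LinearMap.zero_apply, LinearMap.neg_apply, smul_eq_mul]
  ring

theorem Metric.nabla_center_center (g : Metric 𝔫) {z w : 𝔫} (hz : z ∈ LieAlgebra.center ℝ 𝔫)
    (hw : w ∈ LieAlgebra.center ℝ 𝔫) : g.nabla z w = 0 := by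
  refine g.eq_of_form_eq fun y => ?_
  rw [g.form_nabla, lie_eq_zero_of_mem_center hz, lie_eq_zero_of_mem_center' hz,
    lie_eq_zero_of_mem_center' hw]
  simp

theorem Metric.nabla_v_v (g : Metric 𝔫) (h2 : ∀ x y : 𝔫, ⁅x, y⁆ ∈ LieAlgebra.center ℝ 𝔫)
    {x y : 𝔫} (hx : x ∈ g.v) (hy : y ∈ g.v) : g.nabla x y = (1 / 2 : ℝ) • ⁅x, y⁆ := by
  refine g.eq_of_form_eq fun w => ?_
  rw [g.form_nabla, g.form_center_v hx (h2 _ _), g.form_center_v hy (h2 _ _)]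
  simp

end Structure

/-! ### The two components of the conformal Killing equation that are needed -/

section Components

variable {𝔫 : Type*} [LieRing 𝔫] [LieAlgebra ℝ 𝔫] [FiniteDimensional ℝ 𝔫]

omit [FiniteDimensional ℝ 𝔫] in
theorem Metric.odd_vvz {g : Metric 𝔫} {α : Forms 𝔫 3} (hα : α ∈ g.oddForms 3) {a b z : 𝔫}
    (ha : a ∈ g.v) (hb : b ∈ g.v) (hz : z ∈ LieAlgebra.center ℝ 𝔫) : α ![a, b, z] = 0 := by
  refine g.oddForms_apply_eq_zero hα {0, 1} (by decide) _ ?_ ?_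
  · intro i hi
    fin_cases i <;> simp_all
  · intro i hi
    fin_cases i <;> simp_all

omit [FiniteDimensional ℝ 𝔫] in
theorem Metric.odd_zzz {g : Metric 𝔫} {α : Forms 𝔫 3} (hα : α ∈ g.oddForms 3) {a b z : 𝔫}
    (ha : a ∈ LieAlgebra.center ℝ 𝔫) (hb : b ∈ LieAlgebra.center ℝ 𝔫)
    (hz : z ∈ LieAlgebra.center ℝ 𝔫) : α ![a, b, z] = 0 := by
  refine g.oddForms_apply_eq_zero hα ∅ (by decide) _ ?_ ?_
  · intro i hi
    simp at hi
  · intro i hi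
    fin_cases i <;> simp_all

/-- The component of the conformal Killing equation for `y = z ∈ 𝔷` on `𝔳 ⊗ 𝔷 ⊗ 𝔷`. -/
theorem Metric.conformalKilling_vzz {g : Metric 𝔫} {α : Forms 𝔫 3}
    (hα : α ∈ g.conformalKilling 2) {z a z₁ z₂ : 𝔫} (hz : z ∈ LieAlgebra.center ℝ 𝔫)
    (ha : a ∈ g.v) (h₁ : z₁ ∈ LieAlgebra.center ℝ 𝔫) (h₂ : z₂ ∈ LieAlgebra.center ℝ 𝔫) :
    1 / 2 * α ![g.J z a, z₁, z₂] = 1 / ((finrank ℝ 𝔫 : ℝ) - 2) *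
      (g.form z z₁ * g.codiff 2 α ![a, z₂] - g.form z z₂ * g.codiff 2 α ![a, z₁]) := by
  have h := (mem_conformalKilling_two g α).1 hα z a z₁ z₂
  have e : α ![(-(1 / 2) : ℝ) • g.J z a, z₁, z₂] = -(1 / 2) * α ![g.J z a, z₁, z₂] :=
    α.map_vecCons_smul _ _ _
  have k0 : ∀ p q : 𝔫, α ![0, p, q] = 0 := fun p q => α.map_coord_zero (i := 0) rfl
  have k1 : ∀ p q : 𝔫, α ![p, 0, q] = 0 := fun p q => α.map_coord_zero (i := 1) rfl
  have k2 : ∀ p q : 𝔫, α ![p, q, 0] = 0 := fun p q => α.map_coord_zero (i := 2) rfl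
  rw [g.nabla_center_left hz a, g.nabla_center_center hz h₁, g.nabla_center_center hz h₂,
    extDeriv_three_apply, lie_eq_zero_of_mem_center hz, lie_eq_zero_of_mem_center hz,
    lie_eq_zero_of_mem_center hz, lie_eq_zero_of_mem_center' h₁, lie_eq_zero_of_mem_center' h₂,
    lie_eq_zero_of_mem_center' h₂, g.form_center_v ha hz, e] at h
  simp only [k0, k1, k2] at h
  linear_combination h

/-- The component of the conformal Killing equation for `y = x ∈ 𝔳` on `𝔳 ⊗ 𝔳 ⊗ 𝔷`. -/
theorem Metric.conformalKilling_vvz {g : Metric 𝔫} {α : Forms 𝔫 3}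
    (hα : α ∈ g.conformalKilling 2) (hn : ∀ x y : 𝔫, ⁅x, y⁆ ∈ LieAlgebra.center ℝ 𝔫)
    {x a b z : 𝔫} (hx : x ∈ g.v) (ha : a ∈ g.v) (hb : b ∈ g.v)
    (hz : z ∈ LieAlgebra.center ℝ 𝔫) :
    1 / 4 * (α ![b, ⁅x, a⁆, z] - α ![a, ⁅x, b⁆, z] - α ![x, ⁅a, b⁆, z]) +
      1 / 2 * α ![g.J z x, a, b] = -(1 / ((finrank ℝ 𝔫 : ℝ) - 2) *
      (g.form x a * g.codiff 2 α ![b, z] - g.form x b * g.codiff 2 α ![a, z])) := by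
  have h := (mem_conformalKilling_two g α).1 hα x a b z
  have e0 : α ![(1 / 2 : ℝ) • ⁅x, a⁆, b, z] = 1 / 2 * α ![⁅x, a⁆, b, z] :=
    α.map_vecCons_smul _ _ _
  have k0 : ∀ p q : 𝔫, α ![0, p, q] = 0 := fun p q => α.map_coord_zero (i := 0) rfl
  have s01 : ∀ p q r : 𝔫, α ![p, q, r] = -α ![q, p, r] := by
    intro p q r
    have := α.map_swap ![q, p, r] (i := 0) (j := 1) (by decide)
    rw [← this]
    congr 1
    funext t; fin_cases t <;> rfl
  have s12 : ∀ p q r : 𝔫, α ![p, q, r] = -α ![p, r, q] := by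
    intro p q r
    have := α.map_swap ![p, r, q] (i := 1) (j := 2) (by decide)
    rw [← this]
    congr 1
    funext t; fin_cases t <;> rfl
  have e1 : α ![a, (1 / 2 : ℝ) • ⁅x, b⁆, z] = -(1 / 2 * α ![⁅x, b⁆, a, z]) := by
    rw [s01]; congr 1; exact α.map_vecCons_smul _ _ _
  have e2 : α ![a, b, (-(1 / 2) : ℝ) • g.J z x] = -(1 / 2) * α ![g.J z x, a, b] := by
    rw [s12, s01, neg_neg]; exact α.map_vecCons_smul _ _ _
  rw [g.nabla_v_v hn hx ha, g.nabla_v_v hn hx hb, g.nabla_eq_J x z, e0, e1, e2,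
    extDeriv_three_apply, lie_eq_zero_of_mem_center' hz, lie_eq_zero_of_mem_center' hz,
    lie_eq_zero_of_mem_center' hz, g.form_v_center hx hz] at h
  simp only [k0] at h
  rw [s01 b, s01 a, s01 x]
  linear_combination h

end Components

/-! ### Linear algebra of the cross product on `ℝ³` -/

section Cross

theorem pi_three_ext {W : Type*} [AddCommGroup W] [Module ℝ W] {f h : (Fin 3 → ℝ) →ₗ[ℝ] W}
    (h0 : f ![1, 0, 0] = h ![1, 0, 0]) (h1 : f ![0, 1, 0] = h ![0, 1, 0])
    (h2 : f ![0, 0, 1] = h ![0, 0, 1]) : f = h := by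
  refine LinearMap.ext fun w => ?_
  have hw : w = w 0 • ![1, 0, 0] + w 1 • ![0, 1, 0] + w 2 • ![0, 0, 1] := by
    funext t; fin_cases t <;> simp
  rw [hw]
  simp only [map_add, map_smul, h0, h1, h2]

theorem exists_dotProduct_eq (f : (Fin 3 → ℝ) →ₗ[ℝ] ℝ) : ∃ p, ∀ u, u ⬝ᵥ p = f u := by
  refine ⟨![f ![1, 0, 0], f ![0, 1, 0], f ![0, 0, 1]], fun u => ?_⟩
  have hu : u = u 0 • ![1, 0, 0] + u 1 • ![0, 1, 0] + u 2 • ![0, 0, 1] := by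
    funext t; fin_cases t <;> simp
  conv_rhs => rw [hu]
  simp only [map_add, map_smul, dotProduct, Fin.sum_univ_three]
  simp

/-- The off-diagonal entries of `B` vanish because distinct standard basis vectors are orthogonal.
The diagonal entries agree because `eᵢ + eⱼ` is orthogonal to `eᵢ - eⱼ`. This is the criterion by
which every pairing built from `b` and `c` is shown to be scalar. -/
theorem eq_smul_dotProduct_of_orthogonal (B : (Fin 3 → ℝ) →ₗ[ℝ] (Fin 3 → ℝ) →ₗ[ℝ] ℝ)
    (h : ∀ w u, w ⬝ᵥ u = 0 → B w u = 0) : ∃ μ : ℝ, ∀ w u, B w u = μ * (w ⬝ᵥ u) := by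
  refine ⟨B ![1, 0, 0] ![1, 0, 0], fun w u => ?_⟩
  have key : ∀ w : Fin 3 → ℝ, w = w 0 • ![1, 0, 0] + w 1 • ![0, 1, 0] + w 2 • ![0, 0, 1] := by
    intro w
    funext t; fin_cases t <;> simp
  have h01 := h ![1, 0, 0] ![0, 1, 0] (by simp)
  have h02 := h ![1, 0, 0] ![0, 0, 1] (by simp)
  have h10 := h ![0, 1, 0] ![1, 0, 0] (by simp)
  have h12 := h ![0, 1, 0] ![0, 0, 1] (by simp)
  have h20 := h ![0, 0, 1] ![1, 0, 0] (by simp)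
  have h21 := h ![0, 0, 1] ![0, 1, 0] (by simp)
  have d1 := h (![1, 0, 0] + ![0, 1, 0]) (![1, 0, 0] - ![0, 1, 0]) (by simp)
  have d2 := h (![1, 0, 0] + ![0, 0, 1]) (![1, 0, 0] - ![0, 0, 1]) (by simp)
  simp only [map_add, map_sub, LinearMap.add_apply] at d1 d2
  have e1 : B ![0, 1, 0] ![0, 1, 0] = B ![1, 0, 0] ![1, 0, 0] := by linarith
  have e2 : B ![0, 0, 1] ![0, 0, 1] = B ![1, 0, 0] ![1, 0, 0] := by linarith
  conv_lhs => rw [key w, key u]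
  simp only [map_add, map_smul, LinearMap.add_apply, LinearMap.smul_apply, smul_eq_mul, h01, h02,
    h10, h12, h20, h21, e1, e2, dotProduct, Fin.sum_univ_three]
  ring

theorem cross_cross_self_of_orthogonal {w u : Fin 3 → ℝ} (h : w ⬝ᵥ u = 0) :
    (w ⨯₃ u) ⨯₃ w = (w ⬝ᵥ w) • u := by
  rw [cross_cross_eq_smul_sub_smul, dotProduct_comm u w, h, zero_smul, sub_zero]

theorem cross_cross_self_of_orthogonal' {w u : Fin 3 → ℝ} (h : w ⬝ᵥ u = 0) :
    w ⨯₃ (u ⨯₃ w) = (w ⬝ᵥ w) • u := by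
  rw [cross_cross_eq_smul_sub_smul', dotProduct_comm u w, h, zero_smul, sub_zero]

/-- Expansion of `v` in `z × u`, `u`, `z`, cleared of the Gram determinant `|z × u|²`. It shows that
a linear map killing these three vectors is zero when `z × u ≠ 0`. -/
theorem dotProduct_self_cross_smul (z u v : Fin 3 → ℝ) :
    (z ⨯₃ u ⬝ᵥ z ⨯₃ u) • v = (z ⨯₃ u ⬝ᵥ v) • z ⨯₃ u +
      (v ⬝ᵥ u) • ((z ⬝ᵥ z) • u - (u ⬝ᵥ z) • z) -
      (v ⬝ᵥ z) • ((z ⬝ᵥ u) • u - (u ⬝ᵥ u) • z) := by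
  funext t
  simp only [Pi.add_apply, Pi.sub_apply, Pi.smul_apply, smul_eq_mul, cross_apply, dotProduct,
    Fin.sum_univ_three]
  fin_cases t <;> simp <;> ring

end Cross

/-- The linear functional `x ↦ γ (x, a, y)`. -/
def firstSlot {V : Type*} [AddCommGroup V] [Module ℝ V] (γ : Forms V 3) (a y : V) :
    V →ₗ[ℝ] ℝ where
  toFun x := γ ![x, a, y]
  map_add' _ _ := γ.map_vecCons_add _ _ _
  map_smul' _ _ := γ.map_vecCons_smul _ _ _

@[simp]
theorem firstSlot_apply {V : Type*} [AddCommGroup V] [Module ℝ V] (γ : Forms V 3) (a y x : V) :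
    firstSlot γ a y x = γ ![x, a, y] := rfl

theorem form_swap_left {V : Type*} [AddCommGroup V] [Module ℝ V] (γ : Forms V 3) (p q r : V) :
    γ ![p, q, r] = -γ ![q, p, r] := by
  have := γ.map_swap ![q, p, r] (i := 0) (j := 1) (by decide)
  rw [← this]
  congr 1
  funext t; fin_cases t <;> rfl

theorem Metric.form_self_eq_zero {V : Type*} [AddCommGroup V] [Module ℝ V] (g : Metric V) {x : V} :
    g.form x x = 0 ↔ x = 0 := by
  refine ⟨fun h => ?_, fun h => by simp [h]⟩
  by_contra hx
  exact (g.pos x hx).ne' h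

/-- The linear algebra data on `𝔳` extracted from a conformal Killing `3`-form of odd `𝔳`-degree
with component `γ` in `Λ³𝔳*`, when the center is three-dimensional and identified with `ℝ³`.
The component in `𝔳* ⊗ Λ²𝔷*` is `(x, z, w) ↦ g (b (z ⨯₃ w), x)`, and `c` encodes its codifferential;
`br` is the bracket of `𝔳`. -/
structure CenterData {V : Type*} [AddCommGroup V] [Module ℝ V] (g : Metric V)
    (j : (Fin 3 → ℝ) →ₗ[ℝ] V →ₗ[ℝ] V) (br : V → V → Fin 3 → ℝ)
    (b c : (Fin 3 → ℝ) →ₗ[ℝ] V) (γ : Forms V 3) : Prop where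
  form_j : ∀ z x y, g.form (j z x) y = z ⬝ᵥ br x y
  br_skew : ∀ x y, br x y = -br y x
  j_b : ∀ z w, j z (b w) = c (z ⨯₃ w)
  gamma_j : ∀ z x a y, γ ![j z x, a, y] =
    -(1 / 2) * (g.form (b (br x a ⨯₃ z)) y - g.form (b (br x y ⨯₃ z)) a -
      g.form (b (br a y ⨯₃ z)) x) - (g.form x a * g.form y (c z) - g.form x y * g.form a (c z))
  eq_zero_of_j : ∀ x, (∀ z, j z x = 0) → x = 0

/-! ### Rigidity of the data `(b, c, γ)` -/

namespace CenterData

variable {V : Type*} [AddCommGroup V] [Module ℝ V] {g : Metric V}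
  {j : (Fin 3 → ℝ) →ₗ[ℝ] V →ₗ[ℝ] V} {br : V → V → Fin 3 → ℝ}
  {b c : (Fin 3 → ℝ) →ₗ[ℝ] V} {γ : Forms V 3}

theorem j_skew (h : CenterData g j br b c γ) (z : Fin 3 → ℝ) (x y : V) :
    g.form (j z x) y = -g.form x (j z y) := by
  rw [g.symm x, h.form_j, h.form_j, h.br_skew x y, dotProduct_neg]

theorem form_j_self (h : CenterData g j br b c γ) (z : Fin 3 → ℝ) (x : V) :
    g.form x (j z x) = 0 := by
  have := h.j_skew z x x
  rw [g.symm] at this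
  linarith

theorem br_self (h : CenterData g j br b c γ) (x : V) : br x x = 0 := by
  have := h.br_skew x x
  funext t
  have := congrFun this t
  simp only [Pi.neg_apply, Pi.zero_apply] at this ⊢
  linarith

/-- If `b = 0`, then `c` vanishes on all cross products, hence everywhere, so `γ` vanishes as soon
as one argument is some `j z x`. The vector dual to `γ (·, x₁, x₂)` is then orthogonal to all images
of the skew maps `j z`, so it lies in their common kernel, which is zero. -/
theorem gamma_eq_zero [FiniteDimensional ℝ V] (h : CenterData g j br b c γ) (hb : b = 0) :
    γ = 0 := by
  have hz : ∀ z w, c (z ⨯₃ w) = 0 := fun z w => by rw [← h.j_b, hb]; simp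
  have hc : c = 0 := by
    refine pi_three_ext ?_ ?_ ?_
    · simpa [cross_apply] using hz ![0, 1, 0] ![0, 0, 1]
    · simpa [cross_apply] using hz ![0, 0, 1] ![1, 0, 0]
    · simpa [cross_apply] using hz ![1, 0, 0] ![0, 1, 0]
  ext x
  have hx : x = ![x 0, x 1, x 2] := by
    funext t; fin_cases t <;> rfl
  rw [hx]
  set r := (g.form.toDual g.nondegenerate).symm (firstSlot γ (x 1) (x 2)) with hr
  have hrv : ∀ v, g.form r v = γ ![v, x 1, x 2] := fun v =>
    LinearMap.BilinForm.apply_toDual_symm_apply (hB := g.nondegenerate) _ v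
  have r0 : r = 0 := by
    refine h.eq_zero_of_j r fun z => g.eq_of_form_eq fun w => ?_
    rw [h.j_skew, hrv, h.gamma_j, hb, hc]
    simp
  rw [← hrv, r0]
  simp

theorem form_b_cross_j (h : CenterData g j br b c γ) (z u : Fin 3 → ℝ) (x : V) :
    g.form (b (u ⨯₃ z)) (j z x) = -g.form (c (z ⨯₃ (u ⨯₃ z))) x := by
  rw [← h.j_b, h.j_skew, neg_neg]

/-- The consequence of `γ (j z x, j z x, y) = 0`. -/
theorem gamma_j_j (h : CenterData g j br b c γ) (z : Fin 3 → ℝ) (x y : V) :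
    g.form (b (br x (j z x) ⨯₃ z)) y + g.form (c (z ⨯₃ (br x y ⨯₃ z))) x -
      g.form (b (br (j z x) y ⨯₃ z)) x - 2 * (g.form x y * g.form (j z x) (c z)) = 0 := by
  have h1 : γ ![j z x, j z x, y] = 0 :=
    γ.map_eq_zero_of_eq _ (i := 0) (j := 1) rfl (by decide)
  rw [h.gamma_j, h.form_j_self, h.form_b_cross_j] at h1
  linear_combination -2 * h1

/-- For `w ⊥ u`, the vector `|w|² u = (w × u) × w` gives `|w|² c u = j (w × u) (b w)`, which is
orthogonal to `b w` by skewness. -/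
theorem exists_form_b_c (h : CenterData g j br b c γ) :
    ∃ μ : ℝ, ∀ w u, g.form (b w) (c u) = μ * (w ⬝ᵥ u) := by
  refine eq_smul_dotProduct_of_orthogonal (g.form.compl₁₂ b c) fun w u hwu => ?_
  change g.form (b w) (c u) = 0
  rcases eq_or_ne w 0 with rfl | hw
  · simp
  have h1 := h.form_j_self (w ⨯₃ u) (b w)
  rw [h.j_b, cross_cross_self_of_orthogonal hwu, map_smul, map_smul, smul_eq_mul] at h1
  exact (mul_eq_zero.1 h1).resolve_left (by simpa using hw)

/-- Pairing with `u` gives `g (j u (b w), c q) = g (c (u × w), c q) = (u × w) · p = u · (w × p)`. -/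
theorem br_b_c_eq (h : CenterData g j br b c γ) {p q w : Fin 3 → ℝ}
    (hp : ∀ u, u ⬝ᵥ p = g.form (c q) (c u)) : br (b w) (c q) = w ⨯₃ p := by
  refine dotProduct_eq _ _ fun u => ?_
  rw [dotProduct_comm, ← h.form_j, h.j_b, g.symm, ← hp, dotProduct_comm (w ⨯₃ p),
    triple_product_permutation, triple_product_permutation, dotProduct_comm]

/-- The case `x = y = b w` of `gamma_j_j`. -/
theorem form_b_cross_cross (h : CenterData g j br b c γ) {z w p : Fin 3 → ℝ}
    (hp : ∀ u, u ⬝ᵥ p = g.form (c (z ⨯₃ w)) (c u)) :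
    g.form (b ((w ⨯₃ p) ⨯₃ z)) (b w) = g.form (b w) (b w) * (z ⬝ᵥ p) := by
  have h1 := h.gamma_j_j z (b w) (b w)
  rw [h.br_self, h.j_b, h.br_skew (c _) (b w), h.br_b_c_eq hp, ← hp] at h1
  simp only [map_neg, LinearMap.neg_apply, map_zero, LinearMap.zero_apply] at h1
  linarith

/-- In `form_b_cross_cross` take `w = u × z`. Both sides become multiples of `|b (z × u)|² |z|² g (c
z, c u)`, with opposite signs, so this product is zero. -/
theorem form_c_c_eq_zero_or (h : CenterData g j br b c γ) {z u : Fin 3 → ℝ} (hzu : z ⬝ᵥ u = 0) :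
    b (z ⨯₃ u) = 0 ∨ g.form (c z) (c u) = 0 := by
  rcases eq_or_ne z 0 with rfl | hz
  · simp
  have hz' : z ⬝ᵥ z ≠ 0 := by simpa using hz
  obtain ⟨p, hp⟩ := exists_dotProduct_eq ((g.form (c (z ⨯₃ (u ⨯₃ z)))).comp c)
  have h1 := h.form_b_cross_cross hp
  have e1 : z ⨯₃ (u ⨯₃ z) = (z ⬝ᵥ z) • u := cross_cross_self_of_orthogonal' hzu
  have e2 : ((u ⨯₃ z) ⨯₃ p) ⨯₃ z = -(z ⬝ᵥ p) • (u ⨯₃ z) := by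
    rw [cross_cross_eq_smul_sub_smul, dotProduct_comm (u ⨯₃ z) z, dot_cross_self,
      dotProduct_comm p z]
    simp
  have hzp : z ⬝ᵥ p = (z ⬝ᵥ z) * g.form (c z) (c u) := by
    rw [hp, e1]
    simp [g.symm (c u)]
  rw [e2, hzp, ← cross_anticomm z u] at h1
  simp only [map_neg, map_smul, LinearMap.neg_apply, LinearMap.smul_apply, smul_eq_mul,
    neg_neg, smul_neg, neg_smul] at h1
  have h2 : g.form (b (z ⨯₃ u)) (b (z ⨯₃ u)) * (z ⬝ᵥ z) * g.form (c z) (c u) = 0 := by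
    linarith
  rcases mul_eq_zero.1 h2 with h3 | h3
  · exact Or.inl (g.form_self_eq_zero.1 ((mul_eq_zero.1 h3).resolve_right hz'))
  · exact Or.inr h3

/-- A perturbation argument: `u + t (z × u)` is still orthogonal to `z`, while its cross product
with `z` acquires the term `-t |z|² u`. If `b u ≠ 0`, the alternative of `form_c_c_eq_zero_or` is
decided for every `t ≠ 0`, and `t = ±1` together give `g (c z, c u) = 0`. -/
theorem b_eq_zero_of_form_c_c_ne_zero (h : CenterData g j br b c γ) {z u : Fin 3 → ℝ}
    (hzu : z ⬝ᵥ u = 0) (hc : g.form (c z) (c u) ≠ 0) : b u = 0 := by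
  have hz' : z ⬝ᵥ z ≠ 0 := by
    intro h0
    rw [dotProduct_self_eq_zero.1 h0] at hc
    simp at hc
  have h0 : b (z ⨯₃ u) = 0 := (h.form_c_c_eq_zero_or hzu).resolve_right hc
  by_contra hb
  have key : ∀ t : ℝ, t ≠ 0 → g.form (c z) (c u) + t * g.form (c z) (c (z ⨯₃ u)) = 0 := by
    intro t ht
    have h1 : z ⬝ᵥ (u + t • z ⨯₃ u) = 0 := by
      rw [dotProduct_add, hzu, dotProduct_smul, dot_self_cross]; simp
    have e : z ⨯₃ (u + t • z ⨯₃ u) = z ⨯₃ u - (t * (z ⬝ᵥ z)) • u := by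
      rw [map_add, map_smul, ← cross_anticomm (z ⨯₃ u) z, cross_cross_self_of_orthogonal hzu,
        smul_neg, smul_smul, ← sub_eq_add_neg]
    rcases h.form_c_c_eq_zero_or h1 with h2 | h2
    · rw [e, map_sub, h0, map_smul, zero_sub, neg_eq_zero, smul_eq_zero] at h2
      exact absurd h2 (by simp [ht, hz', hb])
    · simpa using h2
  have k1 := key 1 one_ne_zero
  have k2 := key (-1) (by norm_num)
  exact hc (by linarith)

/-- If `g (c z, c u) ≠ 0` for some `z ⊥ u`, then `b` kills `z × u`, `u` and, by symmetry, `z`. These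
form a basis, so `b = 0`. -/
theorem exists_form_c_c (h : CenterData g j br b c γ) (hb : b ≠ 0) :
    ∃ σ : ℝ, ∀ w u, g.form (c w) (c u) = σ * (w ⬝ᵥ u) := by
  refine eq_smul_dotProduct_of_orthogonal (g.form.compl₁₂ c c) fun z u hzu => ?_
  change g.form (c z) (c u) = 0
  by_contra hc
  have h0 : b (z ⨯₃ u) = 0 := (h.form_c_c_eq_zero_or hzu).resolve_right hc
  have h1 : b u = 0 := h.b_eq_zero_of_form_c_c_ne_zero hzu hc
  have h2 : b z = 0 := h.b_eq_zero_of_form_c_c_ne_zero (z := u) (by rwa [dotProduct_comm])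
    (by rwa [g.symm])
  refine hb (LinearMap.ext fun v => ?_)
  have hn : z ⨯₃ u ⬝ᵥ z ⨯₃ u ≠ 0 := by
    intro hn
    have := cross_cross_self_of_orthogonal hzu
    rw [dotProduct_self_eq_zero.1 hn, map_zero, LinearMap.zero_apply, eq_comm,
      smul_eq_zero, dotProduct_self_eq_zero] at this
    rcases this with rfl | rfl <;> simp at hc
  have := congrArg b (dotProduct_self_cross_smul z u v)
  simp only [map_smul, map_add, map_sub, h0, h1, h2, smul_zero, add_zero, sub_zero,
    smul_eq_zero] at this
  exact this.resolve_left hn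

theorem sigma_ne_zero (h : CenterData g j br b c γ) (hb : b ≠ 0) {σ : ℝ}
    (hσ : ∀ w u, g.form (c w) (c u) = σ * (w ⬝ᵥ u)) : σ ≠ 0 := by
  rintro rfl
  have hc : ∀ w, c w = 0 := fun w => g.form_self_eq_zero.1 (by simp [hσ])
  exact hb (LinearMap.ext fun w => h.eq_zero_of_j _ fun z => by rw [h.j_b, hc])

theorem exists_form_b_b (h : CenterData g j br b c γ) (hb : b ≠ 0) :
    ∃ s : ℝ, ∀ w u, g.form (b w) (b u) = s * (w ⬝ᵥ u) := by
  obtain ⟨σ, hσ⟩ := h.exists_form_c_c hb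
  have hσ0 := h.sigma_ne_zero hb hσ
  refine eq_smul_dotProduct_of_orthogonal (g.form.compl₁₂ b b) fun w u hwu => ?_
  change g.form (b w) (b u) = 0
  rcases eq_or_ne w 0 with rfl | hw
  · simp
  have hw' : w ⬝ᵥ w ≠ 0 := by simpa using hw
  have hp : ∀ z v, v ⬝ᵥ (σ • z ⨯₃ w) = g.form (c (z ⨯₃ w)) (c v) := by
    intro z v
    rw [hσ, dotProduct_smul, dotProduct_comm, smul_eq_mul]
  -- With `z = w + u × w` and `p = σ (z × w)`, the right side vanishes because `z ⊥ p`, and the left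
  -- side reduces to `-σ |w|⁴ g (b u, b w)`.
  have h1 := h.form_b_cross_cross (hp (w + u ⨯₃ w))
  have e : (w ⨯₃ (σ • (w + u ⨯₃ w) ⨯₃ w)) ⨯₃ (w + u ⨯₃ w) =
      -(σ * (w ⬝ᵥ w) * (w ⬝ᵥ w)) • u := by
    have e1 : (u ⨯₃ w) ⨯₃ w = -((w ⬝ᵥ w) • u) := by
      rw [← cross_cross_self_of_orthogonal' hwu, cross_anticomm]
    have e2 : (w + u ⨯₃ w) ⨯₃ w = -((w ⬝ᵥ w) • u) := by
      rw [map_add, LinearMap.add_apply, cross_self, zero_add, e1]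
    have e3 : w ⨯₃ (σ • -((w ⬝ᵥ w) • u)) = (σ * (w ⬝ᵥ w)) • u ⨯₃ w := by
      rw [smul_neg, smul_smul, map_neg, map_smul, ← cross_anticomm u w, smul_neg, neg_neg]
    rw [e2, e3, map_smul, LinearMap.smul_apply, map_add, cross_self, add_zero, e1, smul_neg,
      smul_smul, neg_smul]
  rw [e, dotProduct_smul, dot_self_cross, smul_zero, mul_zero, map_smul, map_smul,
    LinearMap.smul_apply, smul_eq_mul, mul_eq_zero] at h1
  rw [g.symm]
  exact h1.resolve_left (by simp [hσ0, hw])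


/-- Putting `x = b w` into `gamma_j_j` yields `key`, whose two sides depend on `(z, w)` only through
`z × w`, apart from the factor `z · w`. Replacing `w` by `w + z` changes this factor and keeps `z ×
w`, so `σ b = μ c`. -/
theorem c_eq_smul_b (h : CenterData g j br b c γ) (hb : b ≠ 0) :
    ∃ κ : ℝ, κ ≠ 0 ∧ ∀ p, c p = κ • b p := by
  obtain ⟨σ, hσ⟩ := h.exists_form_c_c hb
  have hσ0 := h.sigma_ne_zero hb hσ
  obtain ⟨s, hs⟩ := h.exists_form_b_b hb
  obtain ⟨μ, hμ⟩ := h.exists_form_b_c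
  have key : ∀ z w, (z ⬝ᵥ w) • (σ • b (z ⨯₃ w) - μ • c (z ⨯₃ w)) =
      s • j (z ⨯₃ w) (c (z ⨯₃ w)) := by
    intro z w
    refine g.eq_of_form_eq fun y => ?_
    have hp : ∀ v, v ⬝ᵥ (σ • z ⨯₃ w) = g.form (c (z ⨯₃ w)) (c v) := by
      intro v
      rw [hσ, dotProduct_smul, dotProduct_comm, smul_eq_mul]
    have h1 := h.gamma_j_j z (b w) y
    have e1 : (w ⨯₃ (z ⨯₃ w)) ⨯₃ z = (z ⬝ᵥ w) • z ⨯₃ w := by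
      rw [cross_cross_eq_smul_sub_smul, dotProduct_comm (z ⨯₃ w) z, dot_self_cross, zero_smul,
        sub_zero, dotProduct_comm w z]
    have e2 : (z ⨯₃ (w ⨯₃ z)) ⨯₃ w = -((z ⬝ᵥ w) • z ⨯₃ w) := by
      rw [cross_cross_eq_smul_sub_smul', map_sub, LinearMap.sub_apply, map_smul, map_smul,
        LinearMap.smul_apply, LinearMap.smul_apply, cross_self, smul_zero, zero_sub,
        dotProduct_comm w z]
    have t1 : g.form (c (z ⨯₃ (br (b w) y ⨯₃ z))) (b w) =
        -(μ * (z ⬝ᵥ w) * g.form (c (z ⨯₃ w)) y) := by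
      have : w ⬝ᵥ z ⨯₃ (br (b w) y ⨯₃ z) = (z ⨯₃ (w ⨯₃ z)) ⬝ᵥ br (b w) y := by
        simp only [cross_apply, dotProduct, Fin.sum_univ_three]
        simp
        ring
      rw [g.symm, hμ, this, ← h.form_j, h.j_b, e2, map_neg, map_neg, map_smul, map_smul,
        LinearMap.neg_apply, LinearMap.smul_apply, smul_eq_mul]
      ring
    have t2 : g.form (b (br (c (z ⨯₃ w)) y ⨯₃ z)) (b w) =
        s * g.form (j (z ⨯₃ w) (c (z ⨯₃ w))) y := by
      rw [hs, h.form_j, dotProduct_comm, triple_product_permutation, dotProduct_comm,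
        dotProduct_comm (z ⨯₃ w), triple_product_permutation, dotProduct_comm]
    rw [h.j_b, h.br_b_c_eq hp, t1, t2, hσ, dotProduct_comm (z ⨯₃ w) z, dot_self_cross, map_smul,
      map_smul, LinearMap.smul_apply, e1] at h1
    simp only [map_smul, map_sub, LinearMap.smul_apply, LinearMap.sub_apply, smul_eq_mul] at h1 ⊢
    linear_combination h1
  have hσμ : σ • b = μ • c := by
    have step : ∀ z w w', z ⨯₃ w = z ⨯₃ w' → z ⬝ᵥ w = 0 → z ⬝ᵥ w' = 1 →
        σ • b (z ⨯₃ w) = μ • c (z ⨯₃ w) := by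
      intro z w w' h1 h2 h3
      have k1 := key z w
      have k2 := key z w'
      rw [h2, zero_smul] at k1
      rw [h3, one_smul, ← h1, ← k1] at k2
      exact sub_eq_zero.1 k2
    refine pi_three_ext ?_ ?_ ?_
    · simpa [cross_apply] using step ![0, 1, 0] ![0, 0, 1] ![0, 1, 1] (by simp [cross_apply])
        (by simp) (by simp)
    · simpa [cross_apply] using step ![0, 0, 1] ![1, 0, 0] ![1, 0, 1] (by simp [cross_apply])
        (by simp) (by simp)
    · simpa [cross_apply] using step ![1, 0, 0] ![0, 1, 0] ![1, 1, 0] (by simp [cross_apply])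
        (by simp) (by simp)
  have hμ0 : μ ≠ 0 := by
    rintro rfl
    rw [zero_smul, smul_eq_zero] at hσμ
    exact hσμ.elim hσ0 hb
  refine ⟨μ⁻¹ * σ, by simp [hμ0, hσ0], fun p => ?_⟩
  have := LinearMap.congr_fun hσμ p
  rw [mul_smul, ← LinearMap.smul_apply σ b, this, LinearMap.smul_apply, inv_smul_smul₀ hμ0]

/-- The complement `U` of the image of `b` is invariant under all `j z` and commutes with the image
of `b`. Evaluating `γ (b w, j z x, ·)` on `U` in two ways gives the product rule `g2` for the maps
`j z` on `U`. It says that `J0 J1 = κ J2 = -J1 J0` and `Jᵢ² = -2κ²`, which is inconsistent unless `U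
= 0`. -/
theorem eq_zero_of_orthogonal_b (h : CenterData g j br b c γ) {κ s : ℝ} (hκ : κ ≠ 0) (hs0 : 0 < s)
    (hc : ∀ p, c p = κ • b p) (hs : ∀ w u, g.form (b w) (b u) = s * (w ⬝ᵥ u)) {x : V}
    (hx : ∀ w, g.form (b w) x = 0) : x = 0 := by
  have hj : ∀ z x, (∀ w, g.form (b w) x = 0) → ∀ w, g.form (b w) (j z x) = 0 := by
    intro z x hx w
    have := h.j_skew z (b w) x
    rw [h.j_b, hc, map_smul, LinearMap.smul_apply, hx, smul_zero] at this
    linarith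
  have hbr : ∀ w y, (∀ w, g.form (b w) y = 0) → br (b w) y = 0 := by
    intro w y hy
    refine dotProduct_eq _ _ fun u => ?_
    rw [dotProduct_comm, ← h.form_j, h.j_b, hc, map_smul, LinearMap.smul_apply, hy]
    simp
  have dotbr : ∀ x y z w, w ⬝ᵥ br x y ⨯₃ z = g.form (j (z ⨯₃ w) x) y := by
    intro x y z w
    rw [h.form_j, triple_product_permutation, dotProduct_comm]
  have g1 : ∀ a y, (∀ w, g.form (b w) a = 0) → (∀ w, g.form (b w) y = 0) → ∀ p,
      κ * γ ![b p, a, y] = 1 / 2 * s * g.form (j p a) y := by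
    intro a y ha hy
    have step : ∀ z w, κ * γ ![b (z ⨯₃ w), a, y] = 1 / 2 * s * g.form (j (z ⨯₃ w) a) y := by
      intro z w
      have h1 := h.gamma_j z (b w) a y
      have e : γ ![κ • b (z ⨯₃ w), a, y] = κ * γ ![b (z ⨯₃ w), a, y] :=
        γ.map_vecCons_smul _ _ _
      rw [h.j_b, hc, e, hbr w a ha, hbr w y hy, ha, hy, g.symm (b (br a y ⨯₃ z)), hs,
        dotbr, ha w, hy w] at h1
      linear_combination h1
    have hlin : κ • (firstSlot γ a y).comp b = (1 / 2 * s) • (g.form.flip y).comp (j.flip a) := by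
      refine pi_three_ext ?_ ?_ ?_
      · simpa [cross_apply] using step ![0, 1, 0] ![0, 0, 1]
      · simpa [cross_apply] using step ![0, 0, 1] ![1, 0, 0]
      · simpa [cross_apply] using step ![1, 0, 0] ![0, 1, 0]
    exact fun p => LinearMap.congr_fun hlin p
  have g2 : ∀ x, (∀ w, g.form (b w) x = 0) → ∀ z w,
      j w (j z x) = -(κ • j (z ⨯₃ w) x) - (2 * κ ^ 2 * (w ⬝ᵥ z)) • x := by
    intro x hx z w
    -- `r` is the defect of the claimed identity. It lies in `U`, so it may itself serve as test
    -- vector, and the outcome is `s g (r, r) = 0`.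
    set r := j w (j z x) + κ • j (z ⨯₃ w) x + (2 * κ ^ 2 * (w ⬝ᵥ z)) • x with hr
    have hrb : ∀ v, g.form (b v) r = 0 := by
      intro v
      simp only [hr, map_add, map_smul, hj _ _ (hj _ _ hx), hj _ _ hx, hx]
      simp
    have h1 := h.gamma_j z x (b w) r
    have h2 := g1 (j z x) r (hj _ _ hx) hrb w
    rw [form_swap_left, hrb, g.symm (b (br x r ⨯₃ z)), hs, dotbr, hx, g.symm x (b w),
      hx, hc, map_smul (g.form (b w)), hs, smul_eq_mul] at h1
    have h3 : s * g.form r r = 0 := by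
      have : g.form r r = g.form (j w (j z x)) r + κ * g.form (j (z ⨯₃ w) x) r +
          2 * κ ^ 2 * (w ⬝ᵥ z) * g.form x r := by
        have := congrArg (fun v => g.form v r) hr
        simpa only [map_add, map_smul, LinearMap.add_apply, LinearMap.smul_apply,
          smul_eq_mul] using this
      rw [this]
      linear_combination (-2) * h2 - 2 * κ * h1
    have h4 : r = 0 := g.form_self_eq_zero.1 ((mul_eq_zero.1 h3).resolve_left hs0.ne')
    rw [hr] at h4
    rw [← sub_eq_zero, ← h4]
    abel
  have e01 : ∀ x, (∀ w, g.form (b w) x = 0) → j ![1, 0, 0] (j ![0, 1, 0] x) =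
      κ • j ![0, 0, 1] x := by
    intro x hx
    have := g2 x hx ![0, 1, 0] ![1, 0, 0]
    have e : (![0, 1, 0] : Fin 3 → ℝ) ⨯₃ ![1, 0, 0] = -![0, 0, 1] := by simp [cross_apply]
    rw [e, map_neg, LinearMap.neg_apply, smul_neg, neg_neg] at this
    simpa using this
  have e10 : ∀ x, (∀ w, g.form (b w) x = 0) → j ![0, 1, 0] (j ![1, 0, 0] x) =
      -(κ • j ![0, 0, 1] x) := by
    intro x hx
    simpa [cross_apply] using g2 x hx ![1, 0, 0] ![0, 1, 0]
  have e00 : ∀ z : Fin 3 → ℝ, z ⬝ᵥ z = 1 → ∀ x, (∀ w, g.form (b w) x = 0) →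
      j z (j z x) = -((2 * κ ^ 2) • x) := by
    intro z hz x hx
    simpa [hz] using g2 x hx z z
  set J0 := j ![1, 0, 0]
  set J1 := j ![0, 1, 0]
  set J2 := j ![0, 0, 1]
  -- Two values of `(J0 J1)²`: it is `κ² J2² = -2κ⁴`, and by anticommutation it is `-J0² J1² =
  -- -4κ⁴`.
  have a1 : J0 (J1 (J0 (J1 x))) = -((2 * κ ^ 4) • x) := by
    rw [e01 x hx, map_smul, map_smul, e01 _ (hj _ _ hx), e00 _ (by simp) x hx, smul_neg, smul_neg,
      smul_smul, smul_smul]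
    congr 2
    ring
  have a2 : J0 (J1 (J0 (J1 x))) = -((4 * κ ^ 4) • x) := by
    rw [e10 _ (hj _ _ hx), ← e01 _ (hj _ _ hx), map_neg, e00 _ (by simp) x hx, map_neg, map_neg, neg_neg,
      map_smul, map_smul, e00 _ (by simp) x hx, smul_neg, smul_smul]
    congr 2
    ring
  have a3 : (2 * κ ^ 4) • x = 0 := by
    have : (2 * κ ^ 4) • x = (4 * κ ^ 4) • x - (2 * κ ^ 4) • x := by
      rw [← sub_smul]; congr 1; ring
    rw [this, ← neg_inj, neg_sub, neg_zero, sub_eq_zero]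
    rw [← neg_inj, ← a1, a2]
  exact (smul_eq_zero.1 a3).resolve_left (by simp [hκ])

theorem exists_scale (h : CenterData g j br b c γ) (hb : b ≠ 0) :
    ∃ κ s : ℝ, κ ≠ 0 ∧ 0 < s ∧ (∀ w u, g.form (b w) (b u) = s * (w ⬝ᵥ u)) ∧
      (∀ z w, j z (b w) = κ • b (z ⨯₃ w)) ∧ ∀ x, (∀ w, g.form (b w) x = 0) → x = 0 := by
  obtain ⟨s, hs⟩ := h.exists_form_b_b hb
  obtain ⟨κ, hκ, hc⟩ := h.c_eq_smul_b hb
  have hs0 : 0 < s := by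
    obtain ⟨w, hw⟩ : ∃ w, b w ≠ 0 := by
      by_contra! h0
      exact hb (LinearMap.ext h0)
    have h1 := g.pos _ hw
    rw [hs] at h1
    exact pos_of_mul_pos_left h1 (dotProduct_star_self_nonneg w)
  exact ⟨κ, s, hκ, hs0, hs, fun z w => by rw [h.j_b, hc],
    fun x hx => h.eq_zero_of_orthogonal_b hκ hs0 hc hs hx⟩

end CenterData

/-! ### Multilinearity of 3-forms, restriction of metrics, Riesz representation -/

section General

variable {V : Type*} [AddCommGroup V] [Module ℝ V]

theorem form_rotate (γ : Forms V 3) (p q r : V) : γ ![p, q, r] = γ ![q, r, p] := by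
  have h : γ ![q, p, r] = -γ ![q, r, p] := by
    have := γ.map_swap ![q, r, p] (i := 1) (j := 2) (by decide)
    rw [← this]
    congr 1
    funext t; fin_cases t <;> rfl
  rw [form_swap_left, h, neg_neg]

theorem form_add_left (γ : Forms V 3) (p p' q r : V) :
    γ ![p + p', q, r] = γ ![p, q, r] + γ ![p', q, r] := γ.map_vecCons_add _ _ _

theorem form_smul_left (γ : Forms V 3) (k : ℝ) (p q r : V) :
    γ ![k • p, q, r] = k * γ ![p, q, r] := γ.map_vecCons_smul _ _ _

theorem form_add_middle (γ : Forms V 3) (p q q' r : V) :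
    γ ![p, q + q', r] = γ ![p, q, r] + γ ![p, q', r] := by
  rw [form_rotate, form_add_left, ← form_rotate γ p, ← form_rotate γ p]

theorem form_smul_middle (γ : Forms V 3) (k : ℝ) (p q r : V) :
    γ ![p, k • q, r] = k * γ ![p, q, r] := by
  rw [form_rotate, form_smul_left, ← form_rotate γ p]

theorem form_add_right (γ : Forms V 3) (p q r r' : V) :
    γ ![p, q, r + r'] = γ ![p, q, r] + γ ![p, q, r'] := by
  rw [form_rotate, form_add_middle, ← form_rotate γ p, ← form_rotate γ p]

theorem form_smul_right (γ : Forms V 3) (k : ℝ) (p q r : V) :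
    γ ![p, q, k • r] = k * γ ![p, q, r] := by
  rw [form_rotate, form_smul_middle, ← form_rotate γ p]

/-- The restriction of a metric to a subspace. -/
def Metric.restrict (g : Metric V) (W : Submodule ℝ V) : Metric W where
  form := g.form.domRestrict₁₂ W W
  symm x y := g.symm x y
  pos x hx := g.pos x (by simpa using hx)

@[simp]
theorem Metric.restrict_form (g : Metric V) (W : Submodule ℝ V) (x y : W) :
    (g.restrict W).form x y = g.form x y := rfl

theorem Metric.exists_form_eq_sum [FiniteDimensional ℝ V] (g : Metric V) (f : Fin 3 → V →ₗ[ℝ] ℝ) :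
    ∃ b : (Fin 3 → ℝ) →ₗ[ℝ] V, ∀ w x, g.form (b w) x = w 0 * f 0 x + w 1 * f 1 x + w 2 * f 2 x := by
  have hr : ∀ k, ∃ r, ∀ x, g.form r x = f k x := fun k =>
    ⟨(g.form.toDual g.nondegenerate).symm (f k), fun v =>
      LinearMap.BilinForm.apply_toDual_symm_apply (hB := g.nondegenerate) _ v⟩
  choose r hr using hr
  refine ⟨(LinearMap.proj 0).smulRight (r 0) + (LinearMap.proj 1).smulRight (r 1) +
    (LinearMap.proj 2).smulRight (r 2), fun w x => ?_⟩
  simp [hr]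

/-- The isomorphism `Λ²ℝ³ ≅ ℝ³`: an alternating bilinear expression in `z` and `w` is linear in `z ×
w`. -/
theorem form_comp_left_right (α : Forms V 3) (ζ : (Fin 3 → ℝ) →ₗ[ℝ] V) (x : V)
    (z w : Fin 3 → ℝ) : α ![x, ζ z, ζ w] =
      (z ⨯₃ w) 0 * α ![x, ζ ![0, 1, 0], ζ ![0, 0, 1]] +
      (z ⨯₃ w) 1 * α ![x, ζ ![0, 0, 1], ζ ![1, 0, 0]] +
      (z ⨯₃ w) 2 * α ![x, ζ ![1, 0, 0], ζ ![0, 1, 0]] := by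
  have key : ∀ w : Fin 3 → ℝ,
      ζ w = w 0 • ζ ![1, 0, 0] + w 1 • ζ ![0, 1, 0] + w 2 • ζ ![0, 0, 1] := by
    intro w
    rw [← map_smul, ← map_smul, ← map_smul, ← map_add, ← map_add]
    congr 1
    funext t; fin_cases t <;> simp
  have h1 : ∀ p y : V, α ![p, ζ z, y] = z 0 * α ![p, ζ ![1, 0, 0], y] +
      z 1 * α ![p, ζ ![0, 1, 0], y] + z 2 * α ![p, ζ ![0, 0, 1], y] := by
    intro p y
    rw [key z]
    simp only [form_add_middle, form_smul_middle]
  have h2 : ∀ p y : V, α ![p, y, ζ w] = w 0 * α ![p, y, ζ ![1, 0, 0]] +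
      w 1 * α ![p, y, ζ ![0, 1, 0]] + w 2 * α ![p, y, ζ ![0, 0, 1]] := by
    intro p y
    rw [key w]
    simp only [form_add_right, form_smul_right]
  have h3 : ∀ y : V, α ![x, y, y] = 0 := fun y =>
    α.map_eq_zero_of_eq _ (i := 1) (j := 2) rfl (by decide)
  have h4 : ∀ p q : V, α ![x, p, q] = -α ![x, q, p] := fun p q => by
    rw [form_rotate, form_swap_left, ← form_rotate]
  rw [h1, h2, h2, h2, h3, h3, h3, h4 (ζ ![0, 1, 0]) (ζ ![1, 0, 0]),
    h4 (ζ ![1, 0, 0]) (ζ ![0, 0, 1]), h4 (ζ ![0, 0, 1]) (ζ ![0, 1, 0])]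
  simp only [cross_apply]
  simp
  ring

theorem two_form_comp_right (δ : Forms V 2) (ζ : (Fin 3 → ℝ) →ₗ[ℝ] V) (x : V)
    (w : Fin 3 → ℝ) : δ ![x, ζ w] =
      w 0 * δ ![x, ζ ![1, 0, 0]] + w 1 * δ ![x, ζ ![0, 1, 0]] + w 2 * δ ![x, ζ ![0, 0, 1]] := by
  have key : ζ w = w 0 • ζ ![1, 0, 0] + w 1 • ζ ![0, 1, 0] + w 2 • ζ ![0, 0, 1] := by
    rw [← map_smul, ← map_smul, ← map_smul, ← map_add, ← map_add]
    congr 1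
    funext t; fin_cases t <;> simp
  have hs : ∀ p q : V, δ ![p, q] = δ.curryLeft p ![q] := fun p q => rfl
  have ha : ∀ (θ : Forms V 1) (p q : V), θ ![p + q] = θ ![p] + θ ![q] := fun θ p q =>
    θ.map_vecCons_add _ _ _
  have hm : ∀ (θ : Forms V 1) (k : ℝ) (p : V), θ ![k • p] = k * θ ![p] := fun θ k p =>
    θ.map_vecCons_smul _ _ _
  rw [key]
  simp only [hs, ha, hm]

end General

/-! ### Three-dimensional centers and the first assertion -/

section Center

variable {𝔫 : Type*} [LieRing 𝔫] [LieAlgebra ℝ 𝔫] [FiniteDimensional ℝ 𝔫]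

/-- An isometric parametrization of the center by `ℝ³`. -/
structure CenterParam (g : Metric 𝔫) (ζ : (Fin 3 → ℝ) →ₗ[ℝ] 𝔫) : Prop where
  mem : ∀ z, ζ z ∈ LieAlgebra.center ℝ 𝔫
  form : ∀ z w, g.form (ζ z) (ζ w) = z ⬝ᵥ w
  surj : ∀ x ∈ LieAlgebra.center ℝ 𝔫, ∃ z, ζ z = x

theorem Metric.exists_centerParam (g : Metric 𝔫) (h : finrank ℝ (LieAlgebra.center ℝ 𝔫) = 3) :
    ∃ ζ, CenterParam g ζ := by
  obtain ⟨e', he'⟩ := (g.restrict (LieAlgebra.center ℝ 𝔫).toSubmodule).exists_orthonormalBasis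
  have h' : finrank ℝ (LieAlgebra.center ℝ 𝔫).toSubmodule = 3 := h
  set e := e'.reindex (finCongr h') with he
  have h1 : ∀ i, g.form (e i) (e i) = 1 := fun i => by
    simpa [he] using he'.1 ((finCongr h').symm i)
  have h2 : ∀ i j, i ≠ j → g.form (e i) (e j) = 0 := fun i j hij => by
    simpa [he] using he'.2 ((finCongr h').symm i) ((finCongr h').symm j) (by simpa using hij)
  refine ⟨(LieAlgebra.center ℝ 𝔫).toSubmodule.subtype ∘ₗ e.equivFun.symm.toLinearMap,
    fun z => (e.equivFun.symm z).2, fun z w => ?_, fun x hx => ⟨e.equivFun ⟨x, hx⟩, by simp⟩⟩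
  simp only [LinearMap.comp_apply, LinearEquiv.coe_coe, Basis.equivFun_symm_apply,
    map_smul, LinearMap.smul_apply, Fin.sum_univ_three,
    Submodule.subtype_apply, map_add, LinearMap.add_apply, h1, h2 0 1 (by decide),
    h2 0 2 (by decide), h2 1 0 (by decide), h2 1 2 (by decide), h2 2 0 (by decide),
    h2 2 1 (by decide), dotProduct, smul_eq_mul]
  ring

omit [FiniteDimensional ℝ 𝔫] in
theorem CenterParam.injective {g : Metric 𝔫} {ζ : (Fin 3 → ℝ) →ₗ[ℝ] 𝔫} (h : CenterParam g ζ) :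
    Function.Injective ζ := by
  rw [injective_iff_map_eq_zero]
  intro z hz
  rw [← dotProduct_self_eq_zero, ← h.form, hz]
  simp

omit [FiniteDimensional ℝ 𝔫] in
theorem CenterParam.exists_add {g : Metric 𝔫} {ζ : (Fin 3 → ℝ) →ₗ[ℝ] 𝔫} (h : CenterParam g ζ)
    (x : 𝔫) : ∃ p ∈ g.v, ∃ z, x = p + ζ z := by
  obtain ⟨w, hw⟩ := exists_dotProduct_eq ((g.form x).comp ζ)
  refine ⟨x - ζ w, ?_, w, by simp⟩
  intro y hy
  obtain ⟨z, rfl⟩ := h.surj y hy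
  change g.form (ζ z) (x - ζ w) = 0
  rw [map_sub, h.form, hw, g.symm, LinearMap.comp_apply, sub_self]

omit [FiniteDimensional ℝ 𝔫] in
theorem CenterParam.eq_zero_of_odd {g : Metric 𝔫} {ζ : (Fin 3 → ℝ) →ₗ[ℝ] 𝔫}
    (h : CenterParam g ζ) {α : Forms 𝔫 3} (hα : α ∈ g.oddForms 3)
    (hv : ∀ x ∈ g.v, ∀ y ∈ g.v, ∀ w ∈ g.v, α ![x, y, w] = 0)
    (hz : ∀ x ∈ g.v, ∀ z w, α ![x, ζ z, ζ w] = 0) : α = 0 := by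
  ext f
  have hf : f = ![f 0, f 1, f 2] := by
    funext t; fin_cases t <;> rfl
  rw [hf, AlternatingMap.zero_apply]
  obtain ⟨p0, hp0, z0, e0⟩ := h.exists_add (f 0)
  obtain ⟨p1, hp1, z1, e1⟩ := h.exists_add (f 1)
  obtain ⟨p2, hp2, z2, e2⟩ := h.exists_add (f 2)
  rw [e0, e1, e2]
  have v3 : ∀ {x y : 𝔫} {z}, x ∈ g.v → y ∈ g.v → α ![x, y, ζ z] = 0 := fun hx hy =>
    g.odd_vvz hα hx hy (h.mem _)
  simp only [form_add_left, form_add_middle, form_add_right]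
  rw [hv _ hp0 _ hp1 _ hp2, v3 hp0 hp1, hz _ hp0, form_rotate α (ζ z0) p1 p2, v3 hp1 hp2,
    form_rotate α (ζ z0) p1 (ζ z2), hz _ hp1, ← form_rotate α p2 p0 (ζ z1), v3 hp2 hp0,
    ← form_rotate α p2 (ζ z0) (ζ z1), hz _ hp2, g.odd_zzz hα (h.mem _) (h.mem _) (h.mem _)]
  simp

/-- The maps `J (ζ z)` restricted to `𝔳`. -/
noncomputable def CenterParam.j {g : Metric 𝔫} {ζ : (Fin 3 → ℝ) →ₗ[ℝ] 𝔫} (h : CenterParam g ζ) :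
    (Fin 3 → ℝ) →ₗ[ℝ] g.v →ₗ[ℝ] g.v :=
  LinearMap.mk₂ ℝ (fun z x => ⟨g.J (ζ z) x, g.J_mem_v (h.mem z) x⟩)
    (fun _ _ _ => Subtype.ext (by simp)) (fun _ _ _ => Subtype.ext (by simp))
    (fun _ _ _ => Subtype.ext (by simp)) (fun _ _ _ => Subtype.ext (by simp))

theorem CenterParam.coe_j {g : Metric 𝔫} {ζ : (Fin 3 → ℝ) →ₗ[ℝ] 𝔫} (h : CenterParam g ζ)
    (z : Fin 3 → ℝ) (x : g.v) : (h.j z x : 𝔫) = g.J (ζ z) x := rfl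

theorem CenterParam.exists_centerData {g : Metric 𝔫} {ζ : (Fin 3 → ℝ) →ₗ[ℝ] 𝔫}
    (h : CenterParam g ζ) (hn : ∀ x y : 𝔫, ⁅x, y⁆ ∈ LieAlgebra.center ℝ 𝔫) {α : Forms 𝔫 3}
    (hα : α ∈ g.conformalKilling 2) : ∃ (br : g.v → g.v → Fin 3 → ℝ)
      (b c : (Fin 3 → ℝ) →ₗ[ℝ] g.v),
      CenterData (g.restrict g.v) h.j br b c (α.compLinearMap g.v.subtype) ∧
      (∀ x y : g.v, ζ (br x y) = ⁅(x : 𝔫), (y : 𝔫)⁆) ∧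
      ∀ z w (x : g.v), α ![x, ζ z, ζ w] = g.form (b (z ⨯₃ w)) x := by
  have hbr : ∀ x y : g.v, ∃ u, ζ u = ⁅(x : 𝔫), (y : 𝔫)⁆ := fun x y => h.surj _ (hn x y)
  choose br hbr using hbr
  obtain ⟨b, hb⟩ := (g.restrict g.v).exists_form_eq_sum
    ![(firstSlot α (ζ ![0, 1, 0]) (ζ ![0, 0, 1])).comp g.v.subtype,
      (firstSlot α (ζ ![0, 0, 1]) (ζ ![1, 0, 0])).comp g.v.subtype,
      (firstSlot α (ζ ![1, 0, 0]) (ζ ![0, 1, 0])).comp g.v.subtype]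
  have hb' : ∀ z w (x : g.v), α ![x, ζ z, ζ w] = g.form (b (z ⨯₃ w)) x := by
    intro z w x
    rw [form_comp_left_right]
    exact (hb _ x).symm
  set m : ℝ := 1 / ((finrank ℝ 𝔫 : ℝ) - 2) with hm
  set δ := g.codiff 2 α
  -- The factor `2m`, with `m = 1/(n-2)`, absorbs both this coefficient and the `1/2` of the
  -- connection, so that `j z (b w) = c (z × w)` holds without constants.
  let f : 𝔫 → 𝔫 →ₗ[ℝ] ℝ := fun z =>
    { toFun := fun x => 2 * m * δ ![x, z]
      map_add' := fun x y => by
        have : δ ![x + y, z] = δ ![x, z] + δ ![y, z] := δ.map_vecCons_add _ _ _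
        rw [this]; ring
      map_smul' := fun k x => by
        have : δ ![k • x, z] = k * δ ![x, z] := δ.map_vecCons_smul _ _ _
        rw [this, smul_eq_mul, RingHom.id_apply]; ring }
  obtain ⟨c, hc⟩ := (g.restrict g.v).exists_form_eq_sum
    ![(f (ζ ![1, 0, 0])).comp g.v.subtype, (f (ζ ![0, 1, 0])).comp g.v.subtype,
      (f (ζ ![0, 0, 1])).comp g.v.subtype]
  have hc' : ∀ z (x : g.v), m * δ ![x, ζ z] = 1 / 2 * g.form (c z) x := by
    intro z x
    rw [two_form_comp_right, ← g.restrict_form g.v, hc]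
    change _ = 1 / 2 * (z 0 * (2 * m * δ ![x, ζ ![1, 0, 0]]) +
      z 1 * (2 * m * δ ![x, ζ ![0, 1, 0]]) + z 2 * (2 * m * δ ![x, ζ ![0, 0, 1]]))
    ring
  have hj : ∀ z x y, (g.restrict g.v).form (h.j z x) y = z ⬝ᵥ br x y := by
    intro z x y
    rw [g.restrict_form, h.coe_j, g.form_J (h.mem z), ← hbr, h.form, dotProduct_comm]
  have hskew : ∀ x y, br x y = -br y x := by
    intro x y
    apply h.injective
    rw [hbr, map_neg, hbr, lie_skew]
  refine ⟨br, b, c, ⟨hj, hskew, fun z w => ?_, fun z x a y => ?_, fun x hx => ?_⟩, hbr, hb'⟩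
  -- The right side of the `𝔳 ⊗ 𝔷 ⊗ 𝔷` component is the expansion of a double cross product. As
  -- standard basis vectors are cross products, linearity then covers every argument of `b`.
  · have step : ∀ z₁ z₂, h.j z (b (z₁ ⨯₃ z₂)) = c (z ⨯₃ (z₁ ⨯₃ z₂)) := by
      intro z₁ z₂
      refine (g.restrict g.v).eq_of_form_eq fun a => ?_
      have h1 := g.conformalKilling_vzz hα (h.mem z) a.2 (h.mem z₁) (h.mem z₂)
      rw [← hm, mul_sub m, mul_left_comm m, mul_left_comm m, hc', hc', h.form, h.form] at h1
      have h2 := hb' z₁ z₂ (h.j z a)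
      rw [h.coe_j] at h2
      have h3 : (g.restrict g.v).form (h.j z (b (z₁ ⨯₃ z₂))) a =
          -g.form (b (z₁ ⨯₃ z₂)) (g.J (ζ z) a) := by
        rw [hj, hskew, dotProduct_neg, ← hj, g.restrict_form, g.symm, h.coe_j]
      rw [h3, ← h2, cross_cross_eq_smul_sub_smul', map_sub, map_smul, map_smul, map_sub, map_smul,
        map_smul, LinearMap.sub_apply, LinearMap.smul_apply, LinearMap.smul_apply,
        g.restrict_form, g.restrict_form, dotProduct_comm z₁ z]
      simp only [smul_eq_mul]
      linear_combination -2 * h1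
    have hlin : (h.j z).comp b = c.comp (crossProduct z) := by
      refine pi_three_ext ?_ ?_ ?_
      · simpa [cross_apply] using step ![0, 1, 0] ![0, 0, 1]
      · simpa [cross_apply] using step ![0, 0, 1] ![1, 0, 0]
      · simpa [cross_apply] using step ![1, 0, 0] ![0, 1, 0]
    exact LinearMap.congr_fun hlin w
  · have h1 := g.conformalKilling_vvz hα hn x.2 a.2 y.2 (h.mem z)
    have e : (α.compLinearMap g.v.subtype) ![h.j z x, a, y] = α ![g.J (ζ z) x, a, y] := by
      rw [AlternatingMap.compLinearMap_apply]
      congr 1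
      funext t; fin_cases t <;> rfl
    rw [← hm, mul_sub m, mul_left_comm m, mul_left_comm m, hc', hc', ← hbr, ← hbr, ← hbr, hb', hb',
      hb'] at h1
    rw [e]
    simp only [g.restrict_form]
    rw [g.symm y, g.symm a (c z)]
    linear_combination 2 * h1
  -- If every `j u` kills `x`, then `[x, y]` is orthogonal to the center, in which it lies. So `x`
  -- is central, and being in `𝔳` it is zero.
  · have hz : ∀ y : 𝔫, ⁅(x : 𝔫), y⁆ = 0 := by
      intro y
      obtain ⟨u, hu⟩ := h.surj _ (hn x y)
      have h1 := congrArg (fun v : g.v => g.form (v : 𝔫) y) (hx u)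
      simp only [h.coe_j, g.form_J (h.mem u)] at h1
      rw [← hu, h.form] at h1
      have : u = 0 := dotProduct_self_eq_zero.1 (by simpa using h1)
      rw [← hu, this, map_zero]
    have hxc : (x : 𝔫) ∈ LieAlgebra.center ℝ 𝔫 := by
      refine (LieModule.mem_maxTrivSubmodule ℝ 𝔫 𝔫 _).2 fun y => ?_
      rw [← lie_skew, hz, neg_zero]
    exact Subtype.ext (g.form_self_eq_zero.1 (x.2 x hxc))

/-- A conformal Killing `3`-form of odd `𝔳`-degree is determined by its component in
`𝔳* ⊗ Λ²𝔷*`. -/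
theorem CenterParam.eq_zero_of_forall_vzz {g : Metric 𝔫} {ζ : (Fin 3 → ℝ) →ₗ[ℝ] 𝔫}
    (h : CenterParam g ζ) (hn : ∀ x y : 𝔫, ⁅x, y⁆ ∈ LieAlgebra.center ℝ 𝔫) {α : Forms 𝔫 3}
    (hα : α ∈ g.oddConformalKilling 2) (hz : ∀ x ∈ g.v, ∀ z w, α ![x, ζ z, ζ w] = 0) : α = 0 := by
  obtain ⟨br, b, c, hd, -, hb⟩ := h.exists_centerData hn hα.1
  have hb0 : b = 0 := by
    have step : ∀ z w, b (z ⨯₃ w) = 0 := fun z w => by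
      refine (g.restrict g.v).eq_of_form_eq fun x => ?_
      rw [g.restrict_form, ← hb, hz x x.2]
      simp
    refine pi_three_ext ?_ ?_ ?_
    · simpa [cross_apply] using step ![0, 1, 0] ![0, 0, 1]
    · simpa [cross_apply] using step ![0, 0, 1] ![1, 0, 0]
    · simpa [cross_apply] using step ![1, 0, 0] ![0, 1, 0]
  refine h.eq_zero_of_odd hα.2 (fun x hx y hy w hw => ?_) hz
  have h1 := DFunLike.congr_fun (hd.gamma_eq_zero hb0)
    ![(⟨x, hx⟩ : g.v), ⟨y, hy⟩, ⟨w, hw⟩]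
  rw [AlternatingMap.compLinearMap_apply, AlternatingMap.zero_apply] at h1
  rw [← h1]
  congr 1
  funext t; fin_cases t <;> rfl

/-- Duality turns `hjb` into `[b w, b u] = κ s ζ (w × u)`. Since `b` is a homothety onto `𝔳`, only a
rescaling of the two summands is left. -/
theorem exists_isometry_of_scale {g : Metric 𝔫} {ζ : (Fin 3 → ℝ) →ₗ[ℝ] 𝔫} (h : CenterParam g ζ)
    {br : g.v → g.v → Fin 3 → ℝ} (hbr : ∀ x y : g.v, ζ (br x y) = ⁅(x : 𝔫), (y : 𝔫)⁆)
    {b : (Fin 3 → ℝ) →ₗ[ℝ] g.v} {κ s : ℝ} (hκ : κ ≠ 0) (hs0 : 0 < s)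
    (hs : ∀ w u, g.form (b w) (b u) = s * (w ⬝ᵥ u))
    (hjb : ∀ z w, h.j z (b w) = κ • b (z ⨯₃ w))
    (hb : ∀ x : g.v, (∀ w, g.form (b w) x = 0) → x = 0) :
    ∃ (lam : ℝ) (hlam : 0 < lam) (φ : 𝔫 ≃ₗ⁅ℝ⁆ N32),
      ∀ x y, (N32.metric lam hlam).form (φ x) (φ y) = g.form x y := by
  set r := (Real.sqrt s)⁻¹ with hr
  have hrr : r * r * s = 1 := by
    have := Real.mul_self_sqrt hs0.le
    rw [hr, ← mul_inv, this, inv_mul_cancel₀ hs0.ne']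
  have hbb : ∀ w u, ⁅(b w : 𝔫), (b u : 𝔫)⁆ = (κ * s) • ζ (w ⨯₃ u) := by
    intro w u
    rw [← hbr, ← map_smul]
    congr 1
    refine dotProduct_eq _ _ fun v => ?_
    rw [dotProduct_comm, ← h.form, hbr, g.symm, ← g.form_J (h.mem v), ← h.coe_j, hjb,
      Submodule.coe_smul, map_smul, LinearMap.smul_apply, hs, smul_dotProduct, dotProduct_comm,
      triple_product_permutation, dotProduct_comm v, smul_eq_mul, smul_eq_mul, mul_assoc]
  have hbz : ∀ w p, ⁅(b w : 𝔫), ζ p⁆ = 0 := fun w p => lie_eq_zero_of_mem_center' (h.mem p) _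
  -- The factor `r = s^(-1/2)` makes `b` isometric, and `r² κ s = κ` is then the factor needed on
  -- the center to respect brackets. The pulled-back metric is `κ²` on the center, whence `λ = |κ|`;
  -- the sign of `κ` is free.
  let ψ : N32 →ₗ[ℝ] 𝔫 := r • (g.v.subtype ∘ₗ b ∘ₗ N32.fst) + κ • (ζ ∘ₗ N32.snd)
  have hψ : ∀ x, ψ x = r • (b (N32.fst x) : 𝔫) + κ • ζ (N32.snd x) := fun x => rfl
  have hlam : 0 < |κ| := abs_pos.2 hκ
  have hiso : ∀ x y, g.form (ψ x) (ψ y) = (N32.metric |κ| hlam).form x y := by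
    intro x y
    have e1 : ∀ (p : g.v) z, g.form (ζ z) p = 0 := fun p z => g.form_center_v p.2 (h.mem z)
    have e2 : ∀ (p : g.v) z, g.form p (ζ z) = 0 := fun p z => g.form_v_center p.2 (h.mem z)
    have e3 : (N32.metric |κ| hlam).form x y = N32.fst x ⬝ᵥ N32.fst y +
      |κ| ^ 2 * (N32.snd x ⬝ᵥ N32.snd y) := rfl
    rw [hψ, hψ, e3, sq_abs]
    simp only [map_add, map_smul, LinearMap.add_apply, LinearMap.smul_apply, e1, e2, hs, h.form,
      smul_eq_mul]
    linear_combination (N32.fst x ⬝ᵥ N32.fst y) * hrr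
  let ψL : N32 →ₗ⁅ℝ⁆ 𝔫 :=
    { ψ with
      map_lie' := by
        intro x y
        change ψ ⁅x, y⁆ = ⁅ψ x, ψ y⁆
        rw [N32.lie_def, hψ, hψ, hψ]
        simp only [N32.fst_mk, N32.snd_mk, map_zero, lie_add, add_lie, smul_lie, lie_smul, hbb,
          lie_eq_zero_of_mem_center (h.mem _), hbz, Submodule.coe_zero, smul_zero, zero_add,
          add_zero, smul_smul]
        congr 1
        linear_combination (-κ) * hrr }
  have hinj : Function.Injective ψL := by
    rw [injective_iff_map_eq_zero]
    intro x hx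
    have hx' : ψ x = 0 := hx
    refine (N32.metric |κ| hlam).form_self_eq_zero.1 ?_
    rw [← hiso, hx']
    simp
  have hsurj : Function.Surjective ψL := by
    intro x
    obtain ⟨p, hp, z, rfl⟩ := h.exists_add x
    obtain ⟨w, hw⟩ := exists_dotProduct_eq ((g.form p) ∘ₗ g.v.subtype ∘ₗ b)
    have h1 : (⟨p, hp⟩ : g.v) - s⁻¹ • b w = 0 := by
      refine hb _ fun u => ?_
      have := hw u
      simp only [LinearMap.comp_apply, Submodule.subtype_apply] at this
      rw [AddSubgroupClass.coe_sub, Submodule.coe_smul, map_sub, map_smul, hs, g.symm, ← this,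
        smul_eq_mul, dotProduct_comm, inv_mul_cancel_left₀ hs0.ne', sub_self]
    have h2 : p = s⁻¹ • (b w : 𝔫) := by
      have := congrArg (Subtype.val) h1
      simpa [sub_eq_zero] using this
    refine ⟨N32.mk (r • w) (κ⁻¹ • z), ?_⟩
    change ψ _ = _
    rw [hψ, N32.fst_mk, N32.snd_mk, map_smul, map_smul, smul_inv_smul₀ hκ, h2, Submodule.coe_smul,
      smul_smul, eq_inv_of_mul_eq_one_left hrr]
  let Φ : N32 ≃ₗ⁅ℝ⁆ 𝔫 := LieEquiv.ofBijective ψL ⟨hinj, hsurj⟩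
  have hΦ : ∀ x, ψ (Φ.symm x) = x := Φ.apply_symm_apply
  refine ⟨|κ|, hlam, Φ.symm, fun x y => ?_⟩
  rw [← hiso, hΦ, hΦ]

/-- If the center is three-dimensional and there is a non-zero conformal Killing `3`-form of odd
`𝔳`-degree, then the metric Lie algebra is `(𝔫_{3,2}, g_λ)` for some `λ`. -/
theorem Metric.eq_zero_or_exists_isometry (g : Metric 𝔫)
    (hn : ∀ x y : 𝔫, ⁅x, y⁆ ∈ LieAlgebra.center ℝ 𝔫)
    (hdim : finrank ℝ (LieAlgebra.center ℝ 𝔫) = 3) :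
    (∀ α ∈ g.oddConformalKilling 2, α = 0) ∨
      ∃ (lam : ℝ) (hlam : 0 < lam) (φ : 𝔫 ≃ₗ⁅ℝ⁆ N32),
        ∀ x y, (N32.metric lam hlam).form (φ x) (φ y) = g.form x y := by
  refine or_iff_not_imp_left.2 fun hne => ?_
  push Not at hne
  obtain ⟨α, hα, hα0⟩ := hne
  obtain ⟨ζ, h⟩ := g.exists_centerParam hdim
  obtain ⟨br, b, c, hd, hbr, hb⟩ := h.exists_centerData hn hα.1
  have hb0 : b ≠ 0 := by
    rintro rfl
    exact hα0 (h.eq_zero_of_forall_vzz hn hα fun x hx z w => by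
      have := hb z w ⟨x, hx⟩
      simpa using this)
  obtain ⟨κ, s, hκ, hs0, hs, hjb, hbo⟩ := hd.exists_scale hb0
  exact exists_isometry_of_scale h hbr hκ hs0 hs hjb hbo

end Center

/-! ### The Hodge star of decomposable 3-forms -/

section Hodge

variable {V : Type*} [AddCommGroup V] [Module ℝ V]

theorem update_append {X : Type*} {k m : ℕ} (a : Fin k → X) (x : Fin m → X) [DecidableEq (Fin k)]
    (i : Fin k) (v : X) :
    Fin.append (Function.update a i v) x =
      Function.update (Fin.append a x) (Fin.castAdd m i) v := by
  funext t
  refine Fin.addCases (fun s => ?_) (fun s => ?_) t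
  · rcases eq_or_ne s i with rfl | h
    · simp
    · rw [Function.update_of_ne (by simpa using h)]
      simp [h]
  · rw [Function.update_of_ne]
    · simp
    · intro h
      have := congrArg Fin.val h
      simp at this
      omega

theorem forms_sum_apply {ι : Type*} (s : Finset ι) {k : ℕ} (f : ι → Forms V k) (x : Fin k → V) :
    (∑ i ∈ s, f i) x = ∑ i ∈ s, f i x :=
  map_sum (AddMonoidHom.mk' (fun α : Forms V k => α x) fun _ _ => rfl) f s

/-- Insertion of vectors `x` in the last slots of a form. -/
def insertLast {k m : ℕ} (x : Fin m → V) (ω : Forms V (k + m)) : Forms V k where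
  toFun a := ω (Fin.append a x)
  map_update_add' a i v w := by simp only [update_append, AlternatingMap.map_update_add]
  map_update_smul' a i c v := by simp only [update_append, AlternatingMap.map_update_smul]
  map_eq_zero_of_eq' a i j ha hij :=
    ω.map_eq_zero_of_eq (i := Fin.castAdd m i) (j := Fin.castAdd m j) _ (by simpa using ha)
      (by simpa using hij)

theorem insertLast_apply {k m : ℕ} (x : Fin m → V) (ω : Forms V (k + m)) (a : Fin k → V) :
    insertLast x ω a = ω (Fin.append a x) := rfl

theorem wedge_three_apply (θ₁ θ₂ θ₃ : V →ₗ[ℝ] ℝ) (x : Fin 3 → V) :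
    wedge θ₁ (wedge θ₂ (oneForm θ₃)) x =
      θ₁ (x 0) * (θ₂ (x 1) * θ₃ (x 2) - θ₂ (x 2) * θ₃ (x 1)) -
      θ₁ (x 1) * (θ₂ (x 0) * θ₃ (x 2) - θ₂ (x 2) * θ₃ (x 0)) +
      θ₁ (x 2) * (θ₂ (x 0) * θ₃ (x 1) - θ₂ (x 1) * θ₃ (x 0)) := by
  have h1 : ∀ y : Fin 1 → V, oneForm θ₃ y = θ₃ (y 0) := fun y => rfl
  have h2 : ∀ y : Fin 2 → V, wedge θ₂ (oneForm θ₃) y =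
      θ₂ (y 0) * θ₃ (y 1) - θ₂ (y 1) * θ₃ (y 0) := by
    intro y
    rw [wedge_apply]
    refine (Fin.sum_univ_two _).trans ?_
    simp [h1, Fin.removeNth_apply, Fin.succAbove, Fin.tail]
    ring
  rw [wedge_apply]
  refine (Fin.sum_univ_three _).trans ?_
  simp [h2, Fin.removeNth_apply, Fin.succAbove, Fin.tail]
  ring

/-- Multilinear expansion of every argument in the orthonormal basis. -/
theorem Metric.IsOrthonormal.sum_prod_mul {g : Metric V} {ι : Type*} [Fintype ι]
    {e : Basis ι ℝ V} (he : g.IsOrthonormal e) {k : ℕ} (N : Forms V k) (a : Fin k → V) :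
    ∑ i : Fin k → ι, (∏ s, g.form (a s) (e (i s))) * N (fun s => e (i s)) = N a := by
  classical
  have h1 : a = fun s => ∑ j, g.form (a s) (e j) • e j := by
    funext s
    conv_lhs => rw [← he.sum_form_smul (a s)]
    exact Finset.sum_congr rfl fun j _ => by rw [g.symm]
  conv_rhs => rw [h1]
  have := N.toMultilinearMap.map_sum (fun s j => g.form (a s) (e j) • e j)
  simp only [AlternatingMap.coe_multilinearMap] at this
  rw [this]
  refine Finset.sum_congr rfl fun i _ => ?_
  have := N.toMultilinearMap.map_smul_univ (fun s => g.form (a s) (e (i s))) (fun s => e (i s))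
  simp only [AlternatingMap.coe_multilinearMap] at this
  rw [this, smul_eq_mul]

variable [FiniteDimensional ℝ V]

theorem Metric.hodgeStar_apply (g : Metric V) {k m : ℕ} (vol : Forms V (k + m)) (β : Forms V k)
    (x : Fin m → V) : g.hodgeStar vol β x = (k.factorial : ℝ)⁻¹ *
      ∑ i : Fin k → Fin (finrank ℝ V), β (fun s => g.onb (i s)) *
        insertLast x vol (fun s => g.onb (i s)) := by
  rw [Metric.hodgeStar, AlternatingMap.smul_apply, forms_sum_apply, smul_eq_mul]
  rfl

theorem Metric.hodgeStar_add (g : Metric V) {k m : ℕ} (vol : Forms V (k + m)) (β β' : Forms V k) :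
    g.hodgeStar vol (β + β') = g.hodgeStar vol β + g.hodgeStar vol β' := by
  simp only [Metric.hodgeStar, AlternatingMap.add_apply, add_smul, Finset.sum_add_distrib,
    smul_add]

theorem Metric.hodgeStar_smul (g : Metric V) {k m : ℕ} (vol : Forms V (k + m)) (r : ℝ)
    (β : Forms V k) : g.hodgeStar vol (r • β) = r • g.hodgeStar vol β := by
  simp only [Metric.hodgeStar, AlternatingMap.smul_apply, smul_assoc, ← Finset.smul_sum]
  rw [smul_comm]

/-- The Hodge star of a decomposable `3`-form. -/
theorem Metric.hodgeStar_wedge (g : Metric V) {m : ℕ} (vol : Forms V (3 + m)) (p q r : V)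
    (x : Fin m → V) :
    g.hodgeStar vol (wedge (g.flat p) (wedge (g.flat q) (oneForm (g.flat r)))) x =
      vol (Fin.append ![p, q, r] x) := by
  rw [g.hodgeStar_apply, ← insertLast_apply]
  set N := insertLast x vol
  have key : ∀ a b c : V, ∑ i : Fin 3 → Fin (finrank ℝ V), g.form a (g.onb (i 0)) *
      g.form b (g.onb (i 1)) * g.form c (g.onb (i 2)) * N (fun s => g.onb (i s)) =
      N ![a, b, c] := by
    intro a b c
    rw [← g.onb_isOrthonormal.sum_prod_mul N ![a, b, c]]
    simp [Fin.prod_univ_three]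
  have h1 := key p q r
  have h2 := key p r q
  have h3 := key q p r
  have h4 := key r p q
  have h5 := key q r p
  have h6 := key r q p
  have s1 : N ![q, p, r] = -N ![p, q, r] := form_swap_left _ _ _ _
  have s2 : N ![r, p, q] = N ![p, q, r] := form_rotate _ _ _ _
  have s3 : N ![q, r, p] = N ![p, q, r] := (form_rotate _ _ _ _).symm
  have s4 : N ![p, r, q] = -N ![p, q, r] := by rw [form_swap_left, s2]
  have s5 : N ![r, q, p] = -N ![p, q, r] := by rw [form_swap_left, s3]
  -- The wedge is a signed sum over the six permutations of `p, q, r`. As `N` is alternating, each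
  -- contributes `N (p, q, r)`, which cancels the `1/3!` of the star.
  have : ∑ i : Fin 3 → Fin (finrank ℝ V),
      wedge (g.flat p) (wedge (g.flat q) (oneForm (g.flat r))) (fun s => g.onb (i s)) *
        N (fun s => g.onb (i s)) = 6 * N ![p, q, r] := by
    have e : 6 * N ![p, q, r] = N ![p, q, r] - N ![p, r, q] - N ![q, p, r] + N ![r, p, q] +
        N ![q, r, p] - N ![r, q, p] := by
      rw [s1, s2, s3, s4, s5]; ring
    rw [e, ← h1, ← h2, ← h3, ← h4, ← h5, ← h6]
    simp only [← Finset.sum_sub_distrib, ← Finset.sum_add_distrib]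
    refine Finset.sum_congr rfl fun i _ => ?_
    rw [wedge_three_apply]
    simp only [Metric.flat]
    ring
  rw [this]
  norm_num [Nat.factorial]
  ring

end Hodge

/-! ### Explicit geometry of `(𝔫_{3,2}, g_λ)` and the forms `η` and `omega` -/

namespace N32

theorem metric_form (lam : ℝ) (hlam : 0 < lam) (x y : N32) :
    (metric lam hlam).form x y = fst x ⬝ᵥ fst y + lam ^ 2 * (snd x ⬝ᵥ snd y) := rfl

theorem lie_mem_center (x y : N32) : ⁅x, y⁆ ∈ LieAlgebra.center ℝ N32 := by
  refine (LieModule.mem_maxTrivSubmodule ℝ N32 N32 _).2 fun w => ?_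
  exact ext (by simp [lie_def]) (by simp [lie_def])

theorem mem_center_iff {x : N32} : x ∈ LieAlgebra.center ℝ N32 ↔ fst x = 0 := by
  refine ⟨fun h => ?_, fun h => (LieModule.mem_maxTrivSubmodule ℝ N32 N32 _).2 fun w =>
    ext (by simp [lie_def]) (by simp [lie_def, h])⟩
  have key : ∀ w, w ⨯₃ fst x = 0 := by
    intro w
    have := (LieModule.mem_maxTrivSubmodule ℝ N32 N32 _).1 h (mk w 0)
    simpa [lie_def] using congrArg snd this
  have h1 := key ![1, 0, 0]
  have h2 := key ![0, 1, 0]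
  simp [cross_apply] at h1 h2
  funext t
  fin_cases t
  · simpa using h2.2
  · simpa using h1.2
  · simpa using h1.1

theorem mem_v_iff {lam : ℝ} {hlam : 0 < lam} {x : N32} : x ∈ (metric lam hlam).v ↔ snd x = 0 := by
  rw [Metric.mem_v]
  constructor
  · intro h
    have h1 := h (mk 0 (snd x)) (mem_center_iff.2 (by simp))
    simp only [metric_form, fst_mk, snd_mk, zero_dotProduct, zero_add] at h1
    exact dotProduct_self_eq_zero.1 ((mul_eq_zero.1 h1).resolve_left (by positivity))
  · intro h z hz
    simp [metric_form, mem_center_iff.1 hz, h]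

theorem nabla_eq (lam : ℝ) (hlam : 0 < lam) (x y : N32) : (metric lam hlam).nabla x y =
    mk ((lam ^ 2 / 2) • (fst x ⨯₃ snd y + fst y ⨯₃ snd x)) ((1 / 2 : ℝ) • fst x ⨯₃ fst y) := by
  refine (metric lam hlam).eq_of_form_eq fun w => ?_
  rw [Metric.form_nabla]
  simp only [metric_form, lie_def, fst_mk, snd_mk, cross_apply, dotProduct, Fin.sum_univ_three]
  simp
  ring

/-- The isometric parametrization of the center of `(𝔫_{3,2}, g_λ)`. -/
noncomputable def centerMap (lam : ℝ) : (Fin 3 → ℝ) →ₗ[ℝ] N32 where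
  toFun z := mk 0 (lam⁻¹ • z)
  map_add' _ _ := ext (by simp) (by simp)
  map_smul' k z := ext (by simp) (by simp [smul_comm k])

theorem centerMap_apply (lam : ℝ) (z : Fin 3 → ℝ) : centerMap lam z = mk 0 (lam⁻¹ • z) := rfl

theorem centerParam (lam : ℝ) (hlam : 0 < lam) :
    CenterParam (metric lam hlam) (centerMap lam) where
  mem z := mem_center_iff.2 rfl
  form z w := by
    simp only [metric_form, centerMap_apply, fst_mk, snd_mk, smul_dotProduct, dotProduct_smul,
      smul_eq_mul, zero_dotProduct]
    field_simp
    simp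
  surj x hx := ⟨lam • snd x, ext (by simp [centerMap_apply, mem_center_iff.1 hx])
    (by simp [centerMap_apply, hlam.ne'])⟩

theorem J_centerMap (lam : ℝ) (hlam : 0 < lam) (z : Fin 3 → ℝ) (x : N32) :
    (metric lam hlam).J (centerMap lam z) x = mk (lam • z ⨯₃ fst x) 0 := by
  refine (metric lam hlam).eq_of_form_eq fun w => ?_
  rw [Metric.form_J _ ((centerParam lam hlam).mem z)]
  simp only [metric_form, lie_def, centerMap_apply, fst_mk, snd_mk, cross_apply, dotProduct,
    Fin.sum_univ_three]
  simp
  field_simp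
  ring

/-- Coordinates with respect to the orthonormal basis `v₁, v₂, v₃, u₁/λ, u₂/λ, u₃/λ`. -/
noncomputable def coordEquiv (lam : ℝ) (hlam : 0 < lam) : N32 ≃ₗ[ℝ] (Fin 6 → ℝ) where
  toFun x := ![fst x 0, fst x 1, fst x 2, lam * snd x 0, lam * snd x 1, lam * snd x 2]
  invFun f := mk ![f 0, f 1, f 2] (lam⁻¹ • ![f 3, f 4, f 5])
  map_add' x y := by
    funext i; fin_cases i <;> simp [mul_add]
  map_smul' k x := by
    funext i; fin_cases i <;> simp [mul_left_comm]
  left_inv x := by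
    refine ext ?_ ?_
    · funext i; fin_cases i <;> simp
    · funext i; fin_cases i <;> simp [hlam.ne']
  right_inv f := by
    funext i; fin_cases i <;> simp [hlam.ne']

/-- The orthonormal basis `v₁, v₂, v₃, u₁/λ, u₂/λ, u₃/λ`. -/
noncomputable def stdBasis (lam : ℝ) (hlam : 0 < lam) : Basis (Fin 6) ℝ N32 :=
  Basis.ofEquivFun (coordEquiv lam hlam)

theorem stdBasis_apply (lam : ℝ) (hlam : 0 < lam) (i : Fin 6) : stdBasis lam hlam i =
    ![v 0, v 1, v 2, lam⁻¹ • u 0, lam⁻¹ • u 1, lam⁻¹ • u 2] i := by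
  rw [stdBasis, Basis.coe_ofEquivFun]
  refine (coordEquiv lam hlam).symm_apply_eq.2 ?_
  funext j
  fin_cases i <;> fin_cases j <;> simp [coordEquiv, v, u, hlam.ne']

theorem stdBasis_isOrthonormal (lam : ℝ) (hlam : 0 < lam) :
    (metric lam hlam).IsOrthonormal (stdBasis lam hlam) := by
  constructor
  · intro i
    rw [stdBasis_apply]
    fin_cases i <;> simp [metric_form, v, u] <;> field_simp
  · intro i j hij
    rw [stdBasis_apply, stdBasis_apply]
    fin_cases i <;> fin_cases j <;> first | exact absurd rfl hij | simp [metric_form, v, u]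

section Forms

variable (lam : ℝ) (hlam : 0 < lam)

theorem eta_apply (x y w : N32) : eta lam hlam ![x, y, w] =
    lam * (snd x ⬝ᵥ fst y ⨯₃ fst w + snd y ⬝ᵥ fst w ⨯₃ fst x + snd w ⬝ᵥ fst x ⨯₃ fst y) +
      2 * lam ^ 3 * (snd x ⬝ᵥ snd y ⨯₃ snd w) := by
  have hV : ∀ i x, (metric lam hlam).flat (v i) x = fst x i := by
    intro i x
    simp [Metric.flat, metric_form, v]
  have hZ : ∀ i x, (metric lam hlam).flat (lam⁻¹ • u i) x = lam * snd x i := by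
    intro i x
    simp [Metric.flat, metric_form, u]
    field_simp
  simp only [eta, AlternatingMap.add_apply, AlternatingMap.smul_apply, wedge_three_apply, hV, hZ,
    smul_eq_mul, cross_apply, dotProduct, Fin.sum_univ_three]
  simp
  ring

/-- The form `v₁∧z₂∧z₃ + v₂∧z₃∧z₁ + v₃∧z₁∧z₂`. -/
noncomputable def omegaMixed : Forms N32 3 :=
  let A : Fin 3 → N32 →ₗ[ℝ] ℝ := fun i => LinearMap.proj i ∘ₗ fst
  let P : Fin 3 → N32 →ₗ[ℝ] ℝ := fun i => lam • (LinearMap.proj i ∘ₗ snd)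
  wedge (A 0) (wedge (P 1) (oneForm (P 2))) + wedge (A 1) (wedge (P 2) (oneForm (P 0))) +
    wedge (A 2) (wedge (P 0) (oneForm (P 1)))

/-- The form `v₁∧v₂∧v₃`. -/
noncomputable def omegaV : Forms N32 3 :=
  let A : Fin 3 → N32 →ₗ[ℝ] ℝ := fun i => LinearMap.proj i ∘ₗ fst
  wedge (A 0) (wedge (A 1) (oneForm (A 2)))

theorem omegaMixed_apply (x y w : N32) : omegaMixed lam ![x, y, w] =
    lam ^ 2 * (fst x ⬝ᵥ snd y ⨯₃ snd w + fst y ⬝ᵥ snd w ⨯₃ snd x + fst w ⬝ᵥ snd x ⨯₃ snd y) := by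
  simp only [omegaMixed, AlternatingMap.add_apply, wedge_three_apply, cross_apply, dotProduct,
    Fin.sum_univ_three, LinearMap.smul_apply, LinearMap.comp_apply, LinearMap.proj_apply,
    smul_eq_mul]
  simp
  ring

theorem omegaV_apply (x y w : N32) : omegaV ![x, y, w] = fst x ⬝ᵥ fst y ⨯₃ fst w := by
  simp only [omegaV, wedge_three_apply, cross_apply, dotProduct,
    Fin.sum_univ_three, LinearMap.comp_apply, LinearMap.proj_apply]
  simp
  ring

/-- The form `v₁∧z₂∧z₃ + v₂∧z₃∧z₁ + v₃∧z₁∧z₂ + 2 v₁∧v₂∧v₃`, which is `*η` up to sign. -/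
noncomputable def omega : Forms N32 3 := omegaMixed lam + (2 : ℝ) • omegaV

theorem omega_apply (x y w : N32) : omega lam ![x, y, w] =
    lam ^ 2 * (fst x ⬝ᵥ snd y ⨯₃ snd w + fst y ⬝ᵥ snd w ⨯₃ snd x + fst w ⬝ᵥ snd x ⨯₃ snd y) +
      2 * (fst x ⬝ᵥ fst y ⨯₃ fst w) := by
  rw [omega, AlternatingMap.add_apply, AlternatingMap.smul_apply, omegaMixed_apply, omegaV_apply,
    smul_eq_mul]

theorem omega_mem_oddForms : omega lam ∈ (metric lam hlam).oddForms 3 := by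
  have h1 : omegaMixed lam ∈ (metric lam hlam).vDegree 3 1 := by
    intro S x hS hv hz
    have hx : x = ![x 0, x 1, x 2] := by
      funext t; fin_cases t <;> rfl
    have key : ∀ S : Finset (Fin 3), S.card ≠ 1 → (0 ∉ S ∧ 1 ∉ S ∧ 2 ∉ S) ∨ (0 ∈ S ∧ 1 ∈ S) ∨
      (0 ∈ S ∧ 2 ∈ S) ∨ (1 ∈ S ∧ 2 ∈ S) := by decide
    have hv' : ∀ i ∈ S, snd (x i) = 0 := fun i hi => mem_v_iff.1 (hv i hi)
    have hz' : ∀ i ∉ S, fst (x i) = 0 := fun i hi => mem_center_iff.1 (hz i hi)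
    rw [hx, omegaMixed_apply]
    rcases key S hS with ⟨h0, h1, h2⟩ | ⟨h0, h1⟩ | ⟨h0, h1⟩ | ⟨h0, h1⟩
    · simp [hz' _ h0, hz' _ h1, hz' _ h2]
    all_goals simp [hv' _ h0, hv' _ h1]
  have h3 : omegaV ∈ (metric lam hlam).vDegree 3 3 := by
    intro S x hS hv hz
    have hx : x = ![x 0, x 1, x 2] := by
      funext t; fin_cases t <;> rfl
    have key : ∀ S : Finset (Fin 3), S.card ≠ 3 → 0 ∉ S ∨ 1 ∉ S ∨ 2 ∉ S := by decide
    have hz' : ∀ i ∉ S, fst (x i) = 0 := fun i hi => mem_center_iff.1 (hz i hi)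
    rw [hx, omegaV_apply]
    rcases key S hS with h0 | h0 | h0 <;> simp [hz' _ h0]
  have hle : ∀ d, Odd d → (metric lam hlam).vDegree 3 d ≤ (metric lam hlam).oddForms 3 :=
    fun d hd => le_iSup₂_of_le d hd le_rfl
  exact Submodule.add_mem _ (hle 1 (by decide) h1)
    (Submodule.smul_mem _ _ (hle 3 (by decide) h3))

theorem finrank_eq : finrank ℝ N32 = 6 := by
  simpa using finrank_eq_card_basis (stdBasis 1 one_pos)

theorem codiff_apply (α : Forms N32 3) (x y : N32) : (metric lam hlam).codiff 2 α ![x, y] =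
    ∑ i : Fin 6, (α ![(metric lam hlam).nabla (stdBasis lam hlam i) (stdBasis lam hlam i), x, y] +
      α ![stdBasis lam hlam i, (metric lam hlam).nabla (stdBasis lam hlam i) x, y] +
      α ![stdBasis lam hlam i, x, (metric lam hlam).nabla (stdBasis lam hlam i) y]) := by
  rw [(metric lam hlam).codiff_eq (stdBasis_isOrthonormal lam hlam), AlternatingMap.neg_apply,
    forms_sum_apply, ← Finset.sum_neg_distrib]
  refine Finset.sum_congr rfl fun i _ => ?_
  have := deriv_three_apply ((metric lam hlam).nabla (stdBasis lam hlam i)) α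
    (stdBasis lam hlam i) x y
  rw [← neg_inj, neg_neg, ← this]
  rfl

theorem codiff_eta : (metric lam hlam).codiff 2 (eta lam hlam) = 0 := by
  ext f
  have hf : f = ![f 0, f 1] := by
    funext t; fin_cases t <;> rfl
  rw [hf, codiff_apply]
  simp only [Fin.sum_univ_six, stdBasis_apply, eta_apply, nabla_eq, v, u, fst_mk, snd_mk,
    cross_apply, dotProduct, Fin.sum_univ_three]
  simp
  field_simp
  ring

theorem codiff_omega (x y : N32) : (metric lam hlam).codiff 2 (omega lam) ![x, y] =
    2 * lam ^ 2 * (fst x ⬝ᵥ snd y - fst y ⬝ᵥ snd x) := by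
  rw [codiff_apply]
  simp only [Fin.sum_univ_six, stdBasis_apply, omega_apply, nabla_eq, v, u, fst_mk, snd_mk,
    cross_apply, dotProduct, Fin.sum_univ_three]
  simp
  field_simp
  ring

theorem eta_mem_killing : eta lam hlam ∈ (metric lam hlam).killing 2 := by
  refine ⟨(mem_conformalKilling_two _ _).2 ?_, codiff_eta lam hlam⟩
  intro y a b c
  rw [extDeriv_three_apply, codiff_eta]
  simp only [eta_apply, nabla_eq, lie_def, fst_mk, snd_mk, cross_apply,
    dotProduct, Fin.sum_univ_three, AlternatingMap.zero_apply]
  simp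
  ring

theorem omega_mem_conformalKilling : omega lam ∈ (metric lam hlam).conformalKilling 2 := by
  rw [mem_conformalKilling_two]
  intro y a b c
  -- In dimension 6 the coefficient of the codifferential term is `1/(6-2)`. What remains is a
  -- polynomial identity in coordinates.
  rw [extDeriv_three_apply, finrank_eq]
  simp only [omega_apply, codiff_omega, nabla_eq, lie_def, fst_mk, snd_mk, cross_apply,
    dotProduct, Fin.sum_univ_three, metric_form]
  simp
  ring

end Forms
end N32

/-! ### Laplace expansion along three standard basis rows -/

section Determinant

theorem det_cons_single {n : ℕ} (i : Fin (n + 1)) (B : Fin n → Fin (n + 1) → ℝ) :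
    Matrix.det (Matrix.of (Matrix.vecCons (Pi.single i 1) B)) =
      (-1) ^ (i : ℕ) * Matrix.det (Matrix.of fun r => i.removeNth (B r)) := by
  rw [Matrix.det_succ_row_zero, Finset.sum_eq_single i]
  · simp only [Matrix.of_apply, Matrix.cons_val_zero, Pi.single_eq_same, mul_one]
    rfl
  · intro j _ hj
    simp [Pi.single_eq_of_ne hj]
  · simp

theorem removeNth_single {n : ℕ} (i : Fin (n + 1)) (j : Fin n) :
    i.removeNth (Pi.single (i.succAbove j) 1 : Fin (n + 1) → ℝ) = Pi.single j 1 := by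
  funext t
  simp [Fin.removeNth, Pi.single_apply]

theorem det_three_singles (i : Fin 6) (j : Fin 5) (k : Fin 4) (x y z : Fin 6 → ℝ) :
    Matrix.det (Matrix.of ![Pi.single i 1, Pi.single (i.succAbove j) 1,
      Pi.single (i.succAbove (j.succAbove k)) 1, x, y, z]) =
      (-1) ^ (i + j + k : ℕ) * Matrix.det (Matrix.of
        ![fun t => x (i.succAbove (j.succAbove (k.succAbove t))),
          fun t => y (i.succAbove (j.succAbove (k.succAbove t))),
          fun t => z (i.succAbove (j.succAbove (k.succAbove t)))]) := by
  have h1 : (fun r => i.removeNth (![Pi.single (i.succAbove j) 1,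
      Pi.single (i.succAbove (j.succAbove k)) 1, x, y, z] r)) = ![Pi.single j 1,
        Pi.single (j.succAbove k) 1, i.removeNth x, i.removeNth y, i.removeNth z] := by
    rw [← removeNth_single i j, ← removeNth_single i (j.succAbove k)]
    funext r; fin_cases r <;> rfl
  have h2 : (fun r => j.removeNth (![Pi.single (j.succAbove k) 1, i.removeNth x, i.removeNth y,
      i.removeNth z] r)) = ![Pi.single k 1, j.removeNth (i.removeNth x),
        j.removeNth (i.removeNth y), j.removeNth (i.removeNth z)] := by
    rw [← removeNth_single j k]
    funext r; fin_cases r <;> rfl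
  have h3 : (fun r => k.removeNth (![j.removeNth (i.removeNth x), j.removeNth (i.removeNth y),
      j.removeNth (i.removeNth z)] r)) =
        ![fun t => x (i.succAbove (j.succAbove (k.succAbove t))),
          fun t => y (i.succAbove (j.succAbove (k.succAbove t))),
          fun t => z (i.succAbove (j.succAbove (k.succAbove t)))] := by
    funext r; fin_cases r <;> rfl
  rw [det_cons_single, h1, det_cons_single, h2, det_cons_single, h3]
  ring

end Determinant

namespace N32

/-! ### The Hodge dual of `η` -/

section Hodge

variable (lam : ℝ) (hlam : 0 < lam)

theorem det_stdBasis_append (p q r : N32) (x : Fin 3 → N32) :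
    (stdBasis lam hlam).det (Fin.append ![p, q, r] x) =
      Matrix.det (Matrix.of ![coordEquiv lam hlam p, coordEquiv lam hlam q, coordEquiv lam hlam r,
        coordEquiv lam hlam (x 0), coordEquiv lam hlam (x 1), coordEquiv lam hlam (x 2)]) := by
  rw [Basis.det_apply, ← Matrix.det_transpose]
  congr 1
  ext i j
  fin_cases i <;> rfl

/-- The volume form is a nonzero multiple `D` of the determinant in the standard basis, and `*η = -D
omega`. Only the line spanned matters later, so both orientations are covered without finding the
sign of `D`. -/
theorem hodgeStar_eta {vol : Forms N32 (3 + 3)} (hvol : (metric lam hlam).IsVolumeForm vol) :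
    ∃ c : ℝ, c ≠ 0 ∧ (metric lam hlam).hodgeStar vol (eta lam hlam) = c • omega lam := by
  obtain ⟨e, -, rfl⟩ := hvol
  obtain ⟨D, hD, hdet⟩ : ∃ D : ℝ, D ≠ 0 ∧ ∀ y, e.det y = D * (stdBasis lam hlam).det y :=
    ⟨_, (e.isUnit_det (stdBasis lam hlam)).ne_zero, fun y =>
      congrArg (fun ω => ω y) (AlternatingMap.eq_smul_basis_det (stdBasis lam hlam) e.det)⟩
  refine ⟨-D, neg_ne_zero.2 hD, ?_⟩
  ext x
  have hx : x = ![x 0, x 1, x 2] := by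
    funext t; fin_cases t <;> rfl
  have hv : ∀ i, coordEquiv lam hlam (v i) = ![Pi.single 0 1, Pi.single 1 1, Pi.single 2 1] i := by
    intro i; funext t
    fin_cases i <;> fin_cases t <;> simp [coordEquiv, v]
  have hu : ∀ i, coordEquiv lam hlam (lam⁻¹ • u i) =
      ![Pi.single 3 1, Pi.single 4 1, Pi.single 5 1] i := by
    intro i; funext t
    fin_cases i <;> fin_cases t <;> simp [coordEquiv, u, hlam.ne']
  rw [eta]
  simp only [Metric.hodgeStar_add, Metric.hodgeStar_smul, AlternatingMap.add_apply,
    AlternatingMap.smul_apply, Metric.hodgeStar_wedge]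
  simp only [hdet]
  rw [det_stdBasis_append, det_stdBasis_append, det_stdBasis_append,
    det_stdBasis_append, hv, hv, hv, hu, hu, hu]
  have e0 : ∀ x, coordEquiv lam hlam x =
      ![fst x 0, fst x 1, fst x 2, lam * snd x 0, lam * snd x 1, lam * snd x 2] := fun x => rfl
  conv_rhs => rw [hx, omega_apply]
  simp only [e0, cross_apply, dotProduct, Fin.sum_univ_three]
  -- The indices count positions among the columns still present. They encode the triples `z₁v₂v₃`,
  -- `z₂v₃v₁`, `z₃v₁v₂` and `z₁z₂z₃`, that is, the four terms of `η`.
  have d0 := det_three_singles 3 1 1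
  have d1 := det_three_singles 4 2 0
  have d2 := det_three_singles 5 0 0
  have d3 := det_three_singles 3 3 3
  simp only [Matrix.det_fin_three, Matrix.of_apply] at d0 d1 d2 d3
  simp [Fin.succAbove, -Fin.zero_succAbove] at d0 d1 d2 d3
  simp [d0, d1, d2, d3]
  ring

end Hodge

/-! ### One-dimensionality of the space of solutions on `𝔫_{3,2}` -/

section Uniqueness

variable {lam : ℝ} {hlam : 0 < lam}

/-- Since `j z` is `λ` times the cross product with `z`, the relation `j z (b z) = c (z × z) = 0`
makes `b z` parallel to `z` for all `z`. So `b` is a scalar `μ`, which the given value of `α`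
detects, and `b` determines `α`. -/
theorem eq_zero_of_apply_eq_zero {α : Forms N32 3}
    (hα : α ∈ (metric lam hlam).oddConformalKilling 2)
    (h0 : α ![v 0, centerMap lam ![0, 1, 0], centerMap lam ![0, 0, 1]] = 0) : α = 0 := by
  have h := centerParam lam hlam
  refine h.eq_zero_of_forall_vzz lie_mem_center hα ?_
  obtain ⟨br, b, c, hd, -, hb⟩ := h.exists_centerData lie_mem_center hα.1
  have hB : ∀ z, z ⨯₃ fst (b z) = 0 := by
    intro z
    have h1 := congrArg (fun x : (metric lam hlam).v => fst (x : N32)) (hd.j_b z z)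
    simp only [h.coe_j, J_centerMap, fst_mk, cross_self, map_zero, ZeroMemClass.coe_zero] at h1
    exact (smul_eq_zero.1 h1).resolve_left hlam.ne'
  obtain ⟨μ, hμ⟩ := eq_smul_dotProduct_of_orthogonal
    ((dotProductBilin ℝ ℝ).comp (fst ∘ₗ (metric lam hlam).v.subtype ∘ₗ b)) (by
      intro w u hwu
      change fst (b w) ⬝ᵥ u = 0
      rcases eq_or_ne w 0 with rfl | hw
      · simp
      -- For `u ⊥ w` the vector `(w × u) × w` is `|w|² u`, and the triple product moves `w` next to
      -- `b w`, where the cross product vanishes.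
      have h1 : fst (b w) ⬝ᵥ (w ⨯₃ u) ⨯₃ w = 0 := by
        rw [triple_product_permutation, hB, dotProduct_zero]
      rw [cross_cross_self_of_orthogonal hwu, dotProduct_smul, smul_eq_mul] at h1
      exact (mul_eq_zero.1 h1).resolve_left (by simpa using hw))
  have hμ' : ∀ w u, fst (b w) ⬝ᵥ u = μ * (w ⬝ᵥ u) := hμ
  have hform : ∀ z w, ∀ x ∈ (metric lam hlam).v, α ![x, centerMap lam z, centerMap lam w] =
      μ * (z ⨯₃ w ⬝ᵥ fst x) := by
    intro z w x hx
    rw [← hμ', hb z w ⟨x, hx⟩, metric_form, mem_v_iff.1 hx]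
    simp
  have hμ0 : μ = 0 := by
    rw [hform _ _ _ (mem_v_iff.2 rfl)] at h0
    simpa [cross_apply, v] using h0
  intro x hx z w
  rw [hform _ _ _ hx, hμ0, zero_mul]

theorem omega_apply_basis (hlam : 0 < lam) :
    omega lam ![v 0, centerMap lam ![0, 1, 0], centerMap lam ![0, 0, 1]] = 1 := by
  simp [omega_apply, v, centerMap_apply, cross_apply]
  field_simp

/-- As `omega` takes the value 1 on the detecting triple, subtracting the right multiple of it from
any solution leaves a solution vanishing there, which is zero. -/
theorem oddConformalKilling_eq_span :
    (metric lam hlam).oddConformalKilling 2 = Submodule.span ℝ {omega lam} := by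
  have hω : omega lam ∈ (metric lam hlam).oddConformalKilling 2 :=
    ⟨omega_mem_conformalKilling lam hlam, omega_mem_oddForms lam hlam⟩
  refine le_antisymm (fun α hα => ?_) (by simpa using hω)
  rw [Submodule.mem_span_singleton]
  set t := α ![v 0, centerMap lam ![0, 1, 0], centerMap lam ![0, 0, 1]] with ht
  refine ⟨t, ?_⟩
  rw [eq_comm, ← sub_eq_zero]
  refine eq_zero_of_apply_eq_zero (hlam := hlam)
    (Submodule.sub_mem _ hα (Submodule.smul_mem _ t hω)) ?_
  rw [AlternatingMap.sub_apply, AlternatingMap.smul_apply, omega_apply_basis hlam, ← ht]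
  simp

theorem omega_ne_zero (hlam : 0 < lam) : omega lam ≠ 0 := by
  intro h
  have := omega_apply_basis hlam
  rw [h] at this
  simp at this

end Uniqueness

end N32

end MetricLie

theorem proposition5p4 :
    (∀ (𝔫 : Type*) [LieRing 𝔫] [LieAlgebra ℝ 𝔫] [FiniteDimensional ℝ 𝔫] (g : Metric 𝔫),
      IsTwoStepNilpotent 𝔫 → Module.finrank ℝ (LieAlgebra.center ℝ 𝔫) = 3 →
      (∀ α ∈ g.oddConformalKilling 2, α = 0) ∨
      ∃ (lam : ℝ) (hlam : 0 < lam) (φ : 𝔫 ≃ₗ⁅ℝ⁆ N32),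
        ∀ x y, (N32.metric lam hlam).form (φ x) (φ y) = g.form x y) ∧
    (∀ (lam : ℝ) (hlam : 0 < lam),
      Module.finrank ℝ ((N32.metric lam hlam).oddConformalKilling 2) = 1 ∧
      N32.eta lam hlam ∈ (N32.metric lam hlam).killing 2 ∧
      ∀ vol : Forms N32 (3 + 3), (N32.metric lam hlam).IsVolumeForm vol →
        (N32.metric lam hlam).oddConformalKilling 2 =
          Submodule.span ℝ {(N32.metric lam hlam).hodgeStar vol (N32.eta lam hlam)}) := by
  refine ⟨fun 𝔫 _ _ _ g hn hdim => g.eq_zero_or_exists_isometry hn.lie_mem_center hdim,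
    fun lam hlam => ⟨?_, N32.eta_mem_killing lam hlam, fun vol hvol => ?_⟩⟩
  · rw [N32.oddConformalKilling_eq_span]
    exact finrank_span_singleton (N32.omega_ne_zero hlam)
  · obtain ⟨c, hc, h⟩ := N32.hodgeStar_eta lam hlam hvol
    rw [h, N32.oddConformalKilling_eq_span, Submodule.span_singleton_smul_eq hc.isUnit]
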